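/- Let $b$ be a prime power, $s\ge 2$, $d\ge 1$, $t\ge 0$ integers, $\mathbb F_b$ the field with $b$ elements, and $\phi:\{0,\dots,b-1\}\to\mathbb F_b$ a bijection with $\phi(0)=0$. The symbols $\oplus,\ominus$ denote digitwise addition and subtraction modulo $b$ of base-$b$ digits, for non-negative integers and (coordinatewise) for points of $[0,1)^s$. For an integer $n\in[b^k,b^{k+1})$ put $\|n\|_b=b^k$. For a base-$b$ fraction whose first non-zero digit is the $(k+1)$-st one, put $\|\cdot\|_b=b^{-k-1}$ (and $0$ if all digits vanish), and for points let $\|\cdot\|_b$ be the product over the coordinates. A sequence $(\mathbf x_n)_{n\ge0}$ in $[0,1)^s$ is $d$-admissible if $\|n\ominus k\|_b\,\|\mathbf x_n\ominus\mathbf x_k\|_b\ge b^{-d}$ for all $n>k\ge0$. It is a $(t,s)$-sequence in base $b$ if for all $k\ge0$, $m\ge t$ every elementary interval $\prod_{i}[a_ib^{-e_i},(a_i+1)b^{-e_i})$ (integers $e_i\ge0$, $0\le a_i<b^{e_i}$) of volume $b^{t-m}$ contains exactly $b^t$ of the points $\mathbf x_n$, $kb^m\le n<(k+1)b^m$. It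 is digital over $\mathbb F_b$ (with respect to $\phi$) if there are matrices $C^{(1)},\dots,C^{(s)}\in\mathbb F_b^{\mathbb N\times\mathbb N}$ such that, for $n=\sum_{r\ge0}a_r(n)b^r$ with digits $a_r(n)\in\{0,\dots,b-1\}$ and $\mathbf n=(\phi(a_0(n)),\phi(a_1(n)),\dots)$, the $j$-th digit of $x^{(i)}_n$ is $\phi^{-1}$ of the $j$-th coordinate of $\mathbf n C^{(i)\top}$, for all $n$, $i$, $j$ (where, as usual, a digit sequence does not end in $b-1,b-1,\dots$). For $k\ge1$ let $m_k=s^2(d+t)(2^{2k+2}-1)$. For a matrix $C\in\mathbb F_b^{\mathbb N\times\mathbb N}$ let $[C]_m$ be its left upper $m\times m$ block. If $[C]_{m_k}$ is nonsingular, let $h_k$ be the bijection of $\{0,\dots,b^{m_k}-1\}$ for which $h_k(n)=\sum_{j=1}^{m_k}\phi^{-1}(h_{k,j})b^{j-1}$, where $(h_{k,1},\dots,h_{k,m_k})=(\phi(a_0(n)),\dots,\phi(a_{m_k-1}(n)))\,[C]_{m_k}^{\top}$, and let $h_k^{-1}$ be its inverse. Theorem. Let $(\mathbf x_n)_{n\ge0}$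 be a digital $d$-admissible $(t,s)$-sequence in base $b$. Then there exist a matrix $C^{(s+1)}\in\mathbb F_b^{\mathbb N\times\mathbb N}$ and a sequence $(h^{-1}(n))_{n\ge0}$ of non-negative integers such that $[C^{(s+1)}]_{m_k}$ is nonsingular for all $k\ge1$; $h^{-1}(n)=h_l^{-1}(n)=h_k^{-1}(n)$ for all $l>k\ge1$ and $0\le n<b^{m_k}$, where $h_k$ is formed with $C=C^{(s+1)}$; $(\mathbf x_{h^{-1}(n)})_{n\ge0}$ is a $d$-admissible $(t,s)$-sequence in base $b$; and for all $k\ge1$ $$1+\min_{0\le Q<b^{m_k},\ \mathbf w\in E_{m_k}^s}\ \max_{1\le N\le b^{m_k}} N\,D^*\big((\mathbf x_{h^{-1}(n)\oplus Q}\oplus\mathbf w)_{0\le n<N}\big)\ \ge\ 2^{-2}\,b^{-d}\,K_{d,t,s+1}^{-s}\,m_k^{s},$$ where $K_{d,t,s+1}=4(d+t)s^2$, $E_m=\{c\,b^{-m}: c=0,1,\dots,b^m-1\}$, and $D^*((\mathbf y_n)_{0\le n<N})=\sup_{0<z_1,\dots,z_s\le1}\big|\tfrac1N\#\{0\le n<N:\mathbf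 y_n\in\prod_i[0,z_i)\}-z_1\cdots z_s\big|$. -/

import Mathlib

noncomputable section

namespace DigitalSeq

/-! ### Digits and digital (carry-free) arithmetic in base `b` -/

/-- The `j`-th digit `a_j(n)` (`j = 0, 1, 2, …`) of the expansion `n = ∑ a_j(n) b ^ j`. -/
def natDigit (b : ℕ) [NeZero b] (n j : ℕ) : Fin b := Fin.ofNat b (n / b ^ j)

/-- `n ⊕ q`: digitwise addition modulo `b` of natural numbers. (For `b ≥ 2` all digits with index
`j ≥ n + q` of `n` and of `q` vanish.) -/
def natAdd (b : ℕ) [NeZero b] (n q : ℕ) : ℕ :=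
  ∑ j ∈ Finset.range (n + q), ((natDigit b n j + natDigit b q j : Fin b) : ℕ) * b ^ j

/-- `n ⊖ q`: digitwise subtraction modulo `b` of natural numbers. -/
def natSub (b : ℕ) [NeZero b] (n q : ℕ) : ℕ :=
  ∑ j ∈ Finset.range (n + q), ((natDigit b n j - natDigit b q j : Fin b) : ℕ) * b ^ j

/-- `‖n‖_b = b ^ k` for `n ∈ [b ^ k, b ^ (k + 1))`, and `‖0‖_b = 0`. -/
def natNorm (b n : ℕ) : ℝ := if n = 0 then 0 else (b : ℝ) ^ Nat.log b n

/-- `x ⊕ y`: digitwise addition modulo `b` of points of `[0, 1)^s`. -/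
def pointAdd (b : ℕ) [NeZero b] {s : ℕ} (x y : Fin s → ℝ) : Fin s → ℝ :=
  fun i => Real.ofDigits (fun j => Real.digits (x i) b j + Real.digits (y i) b j)

open Classical in
/-- The absolute valuation of the number with digits `u 0, u 1, …` after the point:
`b ^ (-(k + 1))` if exactly the first `k` digits vanish, and `0` if all digits vanish. -/
def digitNorm {b : ℕ} [NeZero b] (u : ℕ → Fin b) : ℝ :=
  if h : ∃ j, u j ≠ 0 then ((b : ℝ) ^ (Nat.find h + 1))⁻¹ else 0

/-- `‖x ⊖ y‖_b`, the product over the coordinates of the absolute valuations of the digitwise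
differences modulo `b`. -/
def pointDist (b : ℕ) [NeZero b] {s : ℕ} (x y : Fin s → ℝ) : ℝ :=
  ∏ i, digitNorm (fun j => Real.digits (x i) b j - Real.digits (y i) b j)

/-! ### Star discrepancy -/

/-- The local discrepancy `#{n < N : x n ∈ [0, y)} - N y_1 ⋯ y_s`. -/
def localDisc {s : ℕ} (x : ℕ → Fin s → ℝ) (N : ℕ) (y : Fin s → ℝ) : ℝ :=
  ({n : ℕ | n < N ∧ ∀ i, x n i ∈ Set.Ico 0 (y i)}.ncard : ℝ) - N * ∏ i, y i

/-- The star discrepancy of the first `N` points of `x`. -/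
def starDisc {s : ℕ} (x : ℕ → Fin s → ℝ) (N : ℕ) : ℝ :=
  ⨆ y : {y : Fin s → ℝ // ∀ i, 0 < y i ∧ y i ≤ 1}, |1 / (N : ℝ) * localDisc x N y.1|

/-! ### Nets, sequences, admissibility -/

/-- The elementary interval `∏ [a_i b ^ (-e_i), (a_i + 1) b ^ (-e_i))`. -/
def elemInterval (b : ℕ) {s : ℕ} (e a : Fin s → ℕ) : Set (Fin s → ℝ) :=
  {x | ∀ i, x i ∈ Set.Ico ((a i : ℝ) / (b : ℝ) ^ e i) (((a i : ℝ) + 1) / (b : ℝ) ^ e i)}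

/-- `P` is a `(t, m, s)`-net in base `b`: every elementary interval of volume
`b ^ (-(e_1 + ⋯ + e_s)) = b ^ (t - m)` contains exactly `b ^ t` of the points. -/
def IsNet (b t m : ℕ) {s : ℕ} (P : Fin (b ^ m) → Fin s → ℝ) : Prop :=
  t ≤ m ∧ (∀ n i, P n i ∈ Set.Ico (0 : ℝ) 1) ∧
    ∀ e a : Fin s → ℕ, (∀ i, a i < b ^ e i) → ∑ i, e i + t = m →
      {n | P n ∈ elemInterval b e a}.ncard = b ^ t

/-- `x` is a `(t, s)`-sequence in base `b`. -/
def IsTSSequence (b t : ℕ) {s : ℕ} (x : ℕ → Fin s → ℝ) : Prop :=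
  (∀ n i, x n i ∈ Set.Ico (0 : ℝ) 1) ∧
    ∀ k m : ℕ, t ≤ m → IsNet b t m (fun n : Fin (b ^ m) => x (k * b ^ m + (n : ℕ)))

/-- `x` is a `d`-admissible sequence in base `b`. -/
def IsAdmissible (b d : ℕ) [NeZero b] {s : ℕ} (x : ℕ → Fin s → ℝ) : Prop :=
  ∀ n k : ℕ, k < n → ((b : ℝ) ^ d)⁻¹ ≤ natNorm b (natSub b n k) * pointDist b (x n) (x k)

/-! ### Digital sequences over the field `F`

The bijection `φ : Fin b ≃ F` identifies the digits `0, …, b - 1` with the elements of the field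
`F`, which therefore has `b` elements; it is assumed that `φ 0 = 0`. -/

/-- The coordinate `j` of the vector `C n`, where `n` is identified with the vector
`(φ (a_0(n)), φ (a_1(n)), …)`; note that `a_r(n) = 0` for `r ≥ n`. -/
def genDigit {b : ℕ} [NeZero b] {F : Type*} [Field F] (φ : Fin b ≃ F) (C : Matrix ℕ ℕ F)
    (n j : ℕ) : F :=
  ∑ r ∈ Finset.range n, C j r * φ (natDigit b n r)

/-- `x` is the digital sequence over `F` with some generating matrices `C 1, …, C s`. As usual
for `b`-adic expansions, the digit sequences of the coordinates are required not to end in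
`b - 1, b - 1, …`, so that they are the digits of a number in `[0, 1)`. -/
def IsDigital {b : ℕ} [NeZero b] {F : Type*} [Field F] (φ : Fin b ≃ F) {s : ℕ}
    (x : ℕ → Fin s → ℝ) : Prop :=
  ∃ C : Fin s → Matrix ℕ ℕ F, ∀ n i,
    (∃ᶠ j in Filter.atTop, (φ.symm (genDigit φ (C i) n j) : ℕ) ≠ b - 1) ∧
      x n i = Real.ofDigits (fun j => φ.symm (genDigit φ (C i) n j))

/-! ### Index permutations -/

/-- The left upper `m × m` block `[C]_m`. -/
def leadBlock {F : Type*} (C : Matrix ℕ ℕ F) (m : ℕ) : Matrix (Fin m) (Fin m) F :=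
  C.submatrix (fun i => (i : ℕ)) (fun i => (i : ℕ))

/-- The map `h` on `[0, b ^ m)` given by the matrix `[C]_m`: the digit vector of `h(n)` is
`n [C]_mᵀ` (the lowest digit comes first). -/
def indexMap {b : ℕ} [NeZero b] {F : Type*} [Field F] (φ : Fin b ≃ F) (C : Matrix ℕ ℕ F)
    (m n : ℕ) : ℕ :=
  ∑ j : Fin m, (φ.symm (Matrix.vecMul (fun r : Fin m => φ (natDigit b n r))
    (leadBlock C m).transpose j) : ℕ) * b ^ (j : ℕ)

/-- The inverse of `indexMap φ C m` on `[0, b ^ m)`; this map is a bijection of `[0, b ^ m)` when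
`[C]_m` is nonsingular. -/
def indexMapInv {b : ℕ} [NeZero b] {F : Type*} [Field F] (φ : Fin b ≃ F) (C : Matrix ℕ ℕ F)
    (m : ℕ) : ℕ → ℕ :=
  Function.invFunOn (indexMap φ C m) (Set.Iio (b ^ m))

/-- `m_k = s² (d + t) (2 ^ (2 k + 2) - 1)`. -/
def blockSize (s d t k : ℕ) : ℕ := s ^ 2 * (d + t) * (2 ^ (2 * k + 2) - 1)

/-- `K_{d,t,s} = 4 (d + t) (s - 1)²`. -/
def constK (d t s : ℕ) : ℝ := 4 * ((d : ℝ) + t) * ((s : ℝ) - 1) ^ 2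

/-- `E_m^s`: the points of `[0, 1)^s` whose coordinates are multiples of `b ^ (-m)`. -/
def gridPoints (b m s : ℕ) : Set (Fin s → ℝ) :=
  {w | ∀ i, ∃ c : ℕ, c < b ^ m ∧ w i = (c : ℝ) / (b : ℝ) ^ m}

end DigitalSeq

end

/-!
The idea is to compare a suitable initial segment of the sequence with a suitable corner box, which
splits into many elementary intervals, each of which contains too few points.

*Discrepancy.* Put `D = d + t + 1` and let `γ = b ^ (-D) + b ^ (-2 D) + ⋯ + b ^ (-M D)` (`corner`).
The cube `[0, γ) ^ s` is the disjoint union of `M ^ s` elementary intervals, of volumes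
`b ^ (-D S)` with `s ≤ S ≤ s M`. Let `N` be an index with the digit `b - 1` at the places `t + D S`
(`S < s M`) and `0` between them, and such that the point number `N` has the first digits of
`(γ, …, γ)` in all coordinates. Let `P` be the largest multiple of `b ^ (t + D S)` up to `N`. Among
the first `P` points, a box of volume `b ^ (-D S)` contains exactly the expected number, by the net
property; among the points from `P` to `N` it contains none, since by the choice of the gaps such a
point would be closer to the point number `N` than admissibility allows. So every box lacks at least
`(b - 1) b ^ (-d - 1)` points, and the defects add up (`localDisc_corner_le`).

*Transfer.* Admissibility and the net property survive a rearrangement of the sequence by a map that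
permutes the blocks `[A b ^ q, (A + 1) b ^ q)` (`BlockPreserving`), and a digital shift of the
points. The inverse index permutation of a unitriangular matrix and the map `n ↦ n ⊕ Q` are
block-preserving, so it suffices to find `N` for the rearranged and shifted sequence.

*The matrix.* The first digits of the point number `n ⊕ Q` and the lowest digits of `h(n)` have to be
prescribed simultaneously. Both are linear in digits, but, as `⊕` is unrelated to the addition of
the field, not in the same unknowns: they are related by a permutation in each digit. Therefore the
matrix is chosen sparse. For every `k`, the columns that are new in the `k`-th block contain a small
set `T` of columns spanning the column space of the generating matrices there; each of the first
rows of `C` receives one additional entry `1` in a column of its own outside of `T`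
(`exists_selection`, `exists_unitriangular`). Then the two systems can be solved one after the other
(`exists_solution`).
-/

namespace DigitalSeq

/-! ### Base-`b` digits of natural numbers -/

section NatDigits

variable {b : ℕ} [NeZero b]

lemma natDigit_val (n j : ℕ) : (natDigit b n j : ℕ) = n / b ^ j % b := by
  simp [natDigit]

lemma natDigit_succ (n j : ℕ) : natDigit b n (j + 1) = natDigit b (n / b) j := by
  ext
  rw [natDigit_val, natDigit_val, pow_succ', Nat.div_div_eq_div_mul]

lemma natDigit_div (n q j : ℕ) : natDigit b (n / b ^ q) j = natDigit b n (q + j) := by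
  ext
  rw [natDigit_val, natDigit_val, Nat.div_div_eq_div_mul, pow_add]

lemma natDigit_eq_zero_of_lt {n m j : ℕ} (hb : 2 ≤ b) (hn : n < b ^ m) (hj : m ≤ j) :
    natDigit b n j = 0 := by
  ext
  rw [natDigit_val, Nat.div_eq_of_lt (hn.trans_le (Nat.pow_le_pow_right (by omega) hj))]
  simp

lemma eq_of_natDigit_eq (hb : 2 ≤ b) {n k : ℕ} (h : ∀ j, natDigit b n j = natDigit b k j) :
    n = k := by
  induction n using Nat.strong_induction_on generalizing k with
  | _ n ih =>
    have h0 : n % b = k % b := by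
      have := congrArg Fin.val (h 0)
      simpa [natDigit_val] using this
    have hs : ∀ j, natDigit b (n / b) j = natDigit b (k / b) j := fun j => by
      rw [← natDigit_succ, ← natDigit_succ, h]
    rcases Nat.eq_zero_or_pos n with rfl | hn
    · by_contra hk
      have hz : ∀ j, natDigit b k j = 0 := fun j => by
        rw [← h j, natDigit_eq_zero_of_lt hb (m := 0) (by simp) (Nat.zero_le j)]
      have h1 := hz (Nat.log b k)
      have h2 := congrArg Fin.val h1
      have hlt : k / b ^ Nat.log b k < b := by
        rw [Nat.div_lt_iff_lt_mul (by positivity), ← pow_succ']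
        exact Nat.lt_pow_succ_log_self (by omega) k
      rw [natDigit_val, Nat.mod_eq_of_lt hlt, Fin.val_zero] at h2
      have h3 : 0 < k / b ^ Nat.log b k :=
        Nat.div_pos (Nat.pow_log_le_self b (Ne.symm hk)) (by positivity)
      omega
    · have := ih (n / b) (Nat.div_lt_self hn (by omega)) hs
      rw [← Nat.div_add_mod n b, ← Nat.div_add_mod k b, this, h0]

/-- Two numbers lie in the same block `[A b ^ q, (A + 1) b ^ q)` iff their digits agree from the
index `q` on. -/
lemma div_pow_eq_iff (hb : 2 ≤ b) {n k q : ℕ} :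
    n / b ^ q = k / b ^ q ↔ ∀ j, q ≤ j → natDigit b n j = natDigit b k j := by
  constructor
  · intro h j hj
    obtain ⟨i, rfl⟩ := Nat.exists_eq_add_of_le hj
    rw [← natDigit_div, ← natDigit_div, h]
  · intro h
    refine eq_of_natDigit_eq hb fun j => ?_
    rw [natDigit_div, natDigit_div, h _ (Nat.le_add_right q j)]

lemma lt_pow_iff_natDigit (hb : 2 ≤ b) {n m : ℕ} :
    n < b ^ m ↔ ∀ j, m ≤ j → natDigit b n j = 0 := by
  have h := div_pow_eq_iff hb (n := n) (k := 0) (q := m)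
  have h0 : ∀ j, natDigit b 0 j = 0 := fun j =>
    natDigit_eq_zero_of_lt hb (m := 0) (by simp) (Nat.zero_le j)
  simp only [Nat.zero_div, h0] at h
  rw [← h, Nat.div_eq_zero_iff, or_iff_right (by positivity)]

lemma mod_pow_eq_of_natDigit {n k q : ℕ}
    (h : ∀ j, j < q → natDigit b n j = natDigit b k j) : n % b ^ q = k % b ^ q := by
  induction q with
  | zero => simp [Nat.mod_one]
  | succ q ih =>
    have h1 := congrArg Fin.val (h q (Nat.lt_succ_self q))
    rw [natDigit_val, natDigit_val] at h1
    rw [Nat.mod_pow_succ, Nat.mod_pow_succ, ih fun j hj => h j (by omega), h1]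

omit [NeZero b] in
lemma sum_digits_lt (c : ℕ → Fin b) (K : ℕ) :
    ∑ j ∈ Finset.range K, (c j : ℕ) * b ^ j < b ^ K := by
  induction K with
  | zero => simp
  | succ K ih =>
    rw [Finset.sum_range_succ]
    have h : ((c K : ℕ) + 1) * b ^ K ≤ b * b ^ K := Nat.mul_le_mul_right _ (c K).isLt
    rw [pow_succ']
    linarith

lemma natDigit_sum (c : ℕ → Fin b) (K j : ℕ) :
    natDigit b (∑ i ∈ Finset.range K, (c i : ℕ) * b ^ i) j = if j < K then c j else 0 := by
  have hb0 : 0 < b := NeZero.pos b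
  induction j generalizing c K with
  | zero =>
    cases K with
    | zero => ext; simp [natDigit_val]
    | succ K =>
      ext
      rw [natDigit_val, Finset.sum_range_succ']
      have : ∑ i ∈ Finset.range K, (c (i + 1) : ℕ) * b ^ (i + 1)
          = b * ∑ i ∈ Finset.range K, (c (i + 1) : ℕ) * b ^ i := by
        rw [Finset.mul_sum]
        exact Finset.sum_congr rfl fun i _ => by ring
      rw [this]
      simp [Nat.mod_eq_of_lt (c 0).isLt]
  | succ j ih =>
    cases K with
    | zero => ext; simp [natDigit_val]
    | succ K =>
      rw [natDigit_succ, Finset.sum_range_succ']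
      have : ∑ i ∈ Finset.range K, (c (i + 1) : ℕ) * b ^ (i + 1)
          = b * ∑ i ∈ Finset.range K, (c (i + 1) : ℕ) * b ^ i := by
        rw [Finset.mul_sum]
        exact Finset.sum_congr rfl fun i _ => by ring
      have hdiv : (b * (∑ i ∈ Finset.range K, (c (i + 1) : ℕ) * b ^ i) + (c 0 : ℕ) * b ^ 0) / b
          = ∑ i ∈ Finset.range K, (c (i + 1) : ℕ) * b ^ i := by
        rw [pow_zero, mul_one, Nat.mul_add_div hb0, Nat.div_eq_of_lt (c 0).isLt, add_zero]
      rw [this, hdiv, ih (fun i => c (i + 1)) K]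
      simp

lemma natDigit_eq_zero_of_le {n j : ℕ} (hb : 2 ≤ b) (h : n ≤ j) : natDigit b n j = 0 :=
  natDigit_eq_zero_of_lt hb (Nat.lt_pow_self (by omega)) h

lemma natDigit_natAdd (hb : 2 ≤ b) (n q j : ℕ) :
    natDigit b (natAdd b n q) j = natDigit b n j + natDigit b q j := by
  rw [natAdd, natDigit_sum (fun j => natDigit b n j + natDigit b q j)]
  split_ifs with h
  · rfl
  · rw [natDigit_eq_zero_of_le hb (by omega), natDigit_eq_zero_of_le hb (by omega), add_zero]

lemma natDigit_natSub (hb : 2 ≤ b) (n q j : ℕ) :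
    natDigit b (natSub b n q) j = natDigit b n j - natDigit b q j := by
  rw [natSub, natDigit_sum (fun j => natDigit b n j - natDigit b q j)]
  split_ifs with h
  · rfl
  · rw [natDigit_eq_zero_of_le hb (by omega), natDigit_eq_zero_of_le hb (by omega), sub_zero]

lemma natAdd_lt_pow (hb : 2 ≤ b) {n q m : ℕ} (hn : n < b ^ m) (hq : q < b ^ m) :
    natAdd b n q < b ^ m := by
  rw [lt_pow_iff_natDigit hb]
  intro j hj
  rw [natDigit_natAdd hb, natDigit_eq_zero_of_lt hb hn hj, natDigit_eq_zero_of_lt hb hq hj,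
    add_zero]

lemma natNorm_natSub_le (hb : 2 ≤ b) {n k q : ℕ} (h : n / b ^ (q + 1) = k / b ^ (q + 1)) :
    natNorm b (natSub b n k) ≤ (b : ℝ) ^ q := by
  have hlt : natSub b n k < b ^ (q + 1) := by
    rw [lt_pow_iff_natDigit hb]
    intro j hj
    rw [natDigit_natSub hb, (div_pow_eq_iff hb).1 h j hj, sub_self]
  unfold natNorm
  have hb1 : (1 : ℝ) ≤ b := by exact_mod_cast (by omega : 1 ≤ b)
  split_ifs with h0
  · positivity
  · exact pow_le_pow_right₀ hb1 (Nat.lt_succ_iff.1 (Nat.log_lt_of_lt_pow h0 hlt))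

/-- `‖n ⊖ k‖ = b ^ q`, where `q` is the index of the highest digit in which `n` and `k` differ. -/
lemma natNorm_natSub_eq (hb : 2 ≤ b) {n k q : ℕ} (h : n / b ^ (q + 1) = k / b ^ (q + 1))
    (h' : n / b ^ q ≠ k / b ^ q) : natNorm b (natSub b n k) = (b : ℝ) ^ q := by
  refine le_antisymm (natNorm_natSub_le hb h) ?_
  have hge : b ^ q ≤ natSub b n k := by
    by_contra hlt
    rw [not_le, lt_pow_iff_natDigit hb] at hlt
    refine h' ((div_pow_eq_iff hb).2 fun j hj => ?_)
    have := hlt j hj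
    rwa [natDigit_natSub hb, sub_eq_zero] at this
  have h0 : natSub b n k ≠ 0 := by
    have : 0 < b ^ q := by positivity
    omega
  have hb1 : (1 : ℝ) ≤ b := by exact_mod_cast (by omega : 1 ≤ b)
  rw [natNorm, if_neg h0]
  exact pow_le_pow_right₀ hb1 (Nat.le_log_of_pow_le (by omega) hge)

omit [NeZero b] in
lemma exists_top_digit (hb : 2 ≤ b) {n k : ℕ} (h : n ≠ k) :
    ∃ q, n / b ^ (q + 1) = k / b ^ (q + 1) ∧ n / b ^ q ≠ k / b ^ q := by
  have hex : ∃ q, n / b ^ q = k / b ^ q := by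
    refine ⟨n + k, ?_⟩
    have hlt : n + k < b ^ (n + k) := Nat.lt_pow_self (by omega)
    rw [Nat.div_eq_of_lt (by omega), Nat.div_eq_of_lt (by omega)]
  classical
  cases hq : Nat.find hex with
  | zero =>
    have := Nat.find_spec hex
    rw [hq] at this
    simp at this
    exact absurd this h
  | succ q =>
    refine ⟨q, hq ▸ Nat.find_spec hex, Nat.find_min hex (by omega)⟩

lemma natNorm_natSub_comm (hb : 2 ≤ b) (n k : ℕ) :
    natNorm b (natSub b n k) = natNorm b (natSub b k n) := by
  rcases eq_or_ne n k with rfl | h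
  · rfl
  · obtain ⟨q, h1, h2⟩ := exists_top_digit hb h
    rw [natNorm_natSub_eq hb h1 h2, natNorm_natSub_eq hb h1.symm h2.symm]

end NatDigits

/-! ### Maps of `ℕ` that permute the blocks -/

/-- `f` preserves the tree of blocks `[A b ^ q, (A + 1) b ^ q)`: two numbers lie in a common block
of length `b ^ q` iff their images do. For `q = 0` this includes injectivity. -/
def BlockPreserving (b : ℕ) (f : ℕ → ℕ) : Prop :=
  ∀ q n k, f n / b ^ q = f k / b ^ q ↔ n / b ^ q = k / b ^ q

section BlockPreserving

variable {b : ℕ} [NeZero b]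

omit [NeZero b] in
lemma BlockPreserving.injective {f : ℕ → ℕ} (hf : BlockPreserving b f) :
    Function.Injective f := fun n k h => by
  have := (hf 0 n k).1 (by rw [h])
  simpa using this

omit [NeZero b] in
lemma BlockPreserving.comp {f g : ℕ → ℕ} (hf : BlockPreserving b f) (hg : BlockPreserving b g) :
    BlockPreserving b (fun n => f (g n)) := fun q n k =>
  (hf q (g n) (g k)).trans (hg q n k)

lemma blockPreserving_natAdd (hb : 2 ≤ b) (q : ℕ) : BlockPreserving b (fun n => natAdd b n q) := by
  intro r n k
  simp only [div_pow_eq_iff hb, natDigit_natAdd hb, add_left_inj]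

lemma BlockPreserving.natNorm_natSub (hb : 2 ≤ b) {f : ℕ → ℕ} (hf : BlockPreserving b f)
    (n k : ℕ) : natNorm b (natSub b (f n) (f k)) = natNorm b (natSub b n k) := by
  rcases eq_or_ne n k with rfl | h
  · rw [natNorm, natNorm, if_pos, if_pos] <;>
    exact eq_of_natDigit_eq hb fun j => by
      rw [natDigit_natSub hb, sub_self, natDigit_eq_zero_of_le hb (Nat.zero_le j)]
  · obtain ⟨q, h1, h2⟩ := exists_top_digit hb h
    rw [natNorm_natSub_eq hb h1 h2,
      natNorm_natSub_eq hb ((hf _ _ _).2 h1) (mt (hf _ _ _).1 h2)]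

end BlockPreserving

/-! ### Base-`b` digits of real numbers -/

section RealDigits

variable {b : ℕ} [NeZero b]

/-- A point `x` of `[0, 1)` lies in `[a b ^ (-e), (a + 1) b ^ (-e))` iff its first `e` digits are
those of `a`, read from the top. -/
lemma mem_Ico_iff_digits (hb : 2 ≤ b) {x : ℝ} (hx : x ∈ Set.Ico (0 : ℝ) 1) {a e : ℕ}
    (ha : a < b ^ e) :
    x ∈ Set.Ico ((a : ℝ) / (b : ℝ) ^ e) (((a : ℝ) + 1) / (b : ℝ) ^ e) ↔
      ∀ j, j < e → Real.digits x b j = natDigit b a (e - 1 - j) := by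
  have hb0 : (0 : ℝ) < b := by exact_mod_cast NeZero.pos b
  have hpos : (0 : ℝ) < (b : ℝ) ^ e := by positivity
  set A := ⌊x * (b : ℝ) ^ e⌋₊ with hA
  have h0 : 0 ≤ x * (b : ℝ) ^ e := mul_nonneg hx.1 hpos.le
  have hAlt : A < b ^ e := by
    rw [hA, Nat.floor_lt h0]
    push_cast
    nlinarith [hx.2]
  have h1 : x ∈ Set.Ico ((a : ℝ) / (b : ℝ) ^ e) (((a : ℝ) + 1) / (b : ℝ) ^ e) ↔ A = a := by
    rw [hA, Nat.floor_eq_iff h0, Set.mem_Ico, div_le_iff₀ hpos, lt_div_iff₀ hpos]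
  have h2 : ∀ j, j < e → Real.digits x b j = natDigit b A (e - 1 - j) := by
    intro j hj
    have : x * (b : ℝ) ^ (j + 1) = x * (b : ℝ) ^ e / ((b ^ (e - 1 - j) : ℕ) : ℝ) := by
      push_cast
      rw [eq_div_iff (by positivity), mul_assoc, ← pow_add]
      congr 2
      omega
    rw [Real.digits, natDigit, this, Nat.floor_div_natCast]
  rw [h1]
  constructor
  · rintro rfl
    exact h2
  · intro h
    refine eq_of_natDigit_eq hb fun i => ?_
    rcases lt_or_ge i e with hi | hi
    · have h3 := h2 (e - 1 - i) (by omega)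
      rw [h (e - 1 - i) (by omega)] at h3
      rw [show e - 1 - (e - 1 - i) = i by omega] at h3
      exact h3.symm
    · rw [natDigit_eq_zero_of_lt hb hAlt hi, natDigit_eq_zero_of_lt hb ha hi]

lemma ofDigits_lt_one (hb : 2 ≤ b) {u : ℕ → Fin b} (h : ∃ j, (u j : ℕ) ≠ b - 1) :
    Real.ofDigits u < 1 := by
  obtain ⟨j, hj⟩ := h
  rw [← Real.ofDigits_const_last_eq_one' (b := b) (by omega)]
  have hle : ∀ i, (u i : ℕ) ≤ b - 1 := fun i => by have := (u i).isLt; omega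
  have hb0 : (0 : ℝ) < b := by exact_mod_cast NeZero.pos b
  refine Summable.tsum_lt_tsum (i := j) (fun i => ?_) ?_ Real.summable_ofDigitsTerm
    Real.summable_ofDigitsTerm
  · unfold Real.ofDigitsTerm
    gcongr
    exact hle i
  · unfold Real.ofDigitsTerm
    gcongr
    exact lt_of_le_of_ne (hle j) hj

lemma ofDigits_mem_Ico (hb : 2 ≤ b) {u : ℕ → Fin b}
    (h : ∃ᶠ j in Filter.atTop, (u j : ℕ) ≠ b - 1) : Real.ofDigits u ∈ Set.Ico (0 : ℝ) 1 :=
  ⟨Real.ofDigits_nonneg u, ofDigits_lt_one hb h.exists⟩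

/-- A digit sequence that does not end in `b - 1, b - 1, …` is the digit sequence of its value. -/
lemma digits_ofDigits (hb : 2 ≤ b) {u : ℕ → Fin b}
    (h : ∃ᶠ j in Filter.atTop, (u j : ℕ) ≠ b - 1) : Real.digits (Real.ofDigits u) b = u := by
  have hb0 : (0 : ℝ) < b := by exact_mod_cast NeZero.pos b
  have hint : ∀ j, ∃ A : ℕ,
      (b : ℝ) ^ j * ∑ i ∈ Finset.range j, Real.ofDigitsTerm u i = A := by
    intro j
    induction j with
    | zero => exact ⟨0, by simp⟩
    | succ j ih =>
      obtain ⟨A, hA⟩ := ih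
      refine ⟨b * A + u j, ?_⟩
      rw [Finset.sum_range_succ, mul_add, pow_succ', mul_assoc, hA, Real.ofDigitsTerm, pow_succ']
      push_cast
      field_simp
  funext j
  obtain ⟨A, hA⟩ := hint j
  have htail : Real.ofDigits (fun i => u (i + (j + 1))) ∈ Set.Ico (0 : ℝ) 1 := by
    refine ⟨Real.ofDigits_nonneg _, ofDigits_lt_one hb ?_⟩
    obtain ⟨i, hi, hne⟩ := Filter.frequently_atTop.1 h (j + 1)
    exact ⟨i - (j + 1), by rwa [Nat.sub_add_cancel hi]⟩
  have hval : Real.ofDigits u * (b : ℝ) ^ (j + 1) =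
      ((b * A + u j : ℕ) : ℝ) + Real.ofDigits (fun i => u (i + (j + 1))) := by
    rw [Real.ofDigits_eq_sum_add_ofDigits u (j + 1), add_mul, Finset.sum_range_succ, add_mul]
    have h1 : (∑ i ∈ Finset.range j, Real.ofDigitsTerm u i) * (b : ℝ) ^ (j + 1) = b * A := by
      rw [← hA]; ring
    rw [h1, Real.ofDigitsTerm]
    push_cast
    field_simp
  have hfloor : ⌊Real.ofDigits u * (b : ℝ) ^ (j + 1)⌋₊ = b * A + u j := by
    rw [hval, Nat.floor_eq_iff (add_nonneg (Nat.cast_nonneg _) htail.1)]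
    exact ⟨by linarith [htail.1], by linarith [htail.2]⟩
  ext
  rw [Real.digits, hfloor]
  simp [Nat.mod_eq_of_lt (u j).isLt]

lemma digits_grid {c m j : ℕ} (hj : m ≤ j) :
    Real.digits ((c : ℝ) / (b : ℝ) ^ m) b j = 0 := by
  have hb0 : (0 : ℝ) < b := by exact_mod_cast NeZero.pos b
  obtain ⟨i, rfl⟩ := Nat.exists_eq_add_of_le hj
  have : (c : ℝ) / (b : ℝ) ^ m * (b : ℝ) ^ (m + i + 1) = ((b * (c * b ^ i) : ℕ) : ℝ) := by
    push_cast
    rw [pow_succ, pow_add]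
    field_simp
  ext
  rw [Real.digits, this, Nat.floor_natCast]
  simp

/-- Adding a point whose digits vanish from some index on does not create a digit sequence that
ends in `b - 1, b - 1, …`. -/
lemma frequently_digits_add {s m : ℕ} {x w : Fin s → ℝ} (hw : w ∈ gridPoints b m s) {i : Fin s}
    (hx : ∃ᶠ j in Filter.atTop, (Real.digits (x i) b j : ℕ) ≠ b - 1) :
    ∃ᶠ j in Filter.atTop, ((Real.digits (x i) b j + Real.digits (w i) b j : Fin b) : ℕ) ≠ b - 1 := by
  obtain ⟨c, -, hc⟩ := hw i
  refine (hx.and_eventually (Filter.eventually_ge_atTop m)).mono fun j hj => ?_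
  rw [hc, digits_grid hj.2, add_zero]
  exact hj.1

lemma digitNorm_congr {u v : ℕ → Fin b} (h : ∀ j, u j ≠ 0 ↔ v j ≠ 0) :
    digitNorm u = digitNorm v := by
  classical
  unfold digitNorm
  by_cases h0 : ∃ j, u j ≠ 0
  · have h1 : ∃ j, v j ≠ 0 := h0.imp fun j hj => (h j).1 hj
    rw [dif_pos h0, dif_pos h1, Nat.find_congr' fun {j} => h j]
  · have h1 : ¬ ∃ j, v j ≠ 0 := fun h1 => h0 (h1.imp fun j hj => (h j).2 hj)
    rw [dif_neg h0, dif_neg h1]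

lemma pointDist_comm {s : ℕ} (x y : Fin s → ℝ) : pointDist b x y = pointDist b y x :=
  Finset.prod_congr rfl fun i _ => digitNorm_congr fun j => by
    rw [sub_ne_zero, sub_ne_zero, ne_comm]

lemma digitNorm_le (hb : 2 ≤ b) {u : ℕ → Fin b} {e : ℕ} (h : ∀ j, j < e → u j = 0) :
    digitNorm u ≤ ((b : ℝ) ^ (e + 1))⁻¹ := by
  classical
  have hb1 : (1 : ℝ) ≤ b := by exact_mod_cast (by omega : 1 ≤ b)
  unfold digitNorm
  split_ifs with h0
  · have : e ≤ Nat.find h0 := by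
      rw [Nat.le_find_iff]
      intro j hj hne
      exact hne (h j hj)
    gcongr
  · positivity

lemma digitNorm_nonneg (u : ℕ → Fin b) : 0 ≤ digitNorm u := by
  unfold digitNorm
  split_ifs <;> positivity

end RealDigits

/-! ### Rearrangements and digital shifts of sequences -/

section Transfer

variable {b : ℕ} [NeZero b] {s : ℕ}

lemma IsAdmissible.comp (hb : 2 ≤ b) {d : ℕ} {x : ℕ → Fin s → ℝ} (hx : IsAdmissible b d x)
    {f : ℕ → ℕ} (hf : BlockPreserving b f) : IsAdmissible b d (fun n => x (f n)) := by
  intro n k hkn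
  rw [← hf.natNorm_natSub hb]
  rcases lt_or_gt_of_ne (hf.injective.ne hkn.ne) with h | h
  · exact hx _ _ h
  · rw [natNorm_natSub_comm hb, pointDist_comm]
    exact hx _ _ h

/-- A block-preserving map carries each block bijectively onto a block, so that it turns
`(t, s)`-sequences into `(t, s)`-sequences. -/
lemma IsTSSequence.comp {t : ℕ} {x : ℕ → Fin s → ℝ} (hx : IsTSSequence b t x)
    {f : ℕ → ℕ} (hf : BlockPreserving b f) : IsTSSequence b t (fun n => x (f n)) := by
  refine ⟨fun n i => hx.1 _ i, fun k m hm => ⟨hm, fun n i => hx.1 _ i, fun e a ha he => ?_⟩⟩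
  have hpos : 0 < b ^ m := pow_pos (NeZero.pos b) m
  set k' := f (k * b ^ m) / b ^ m with hk'
  have hdiv : ∀ n : Fin (b ^ m), f (k * b ^ m + n) / b ^ m = k' := fun n => by
    rw [hk', hf, mul_comm, Nat.mul_add_div hpos, Nat.div_eq_of_lt n.isLt,
      Nat.mul_div_cancel_left _ hpos, add_zero]
  let g : Fin (b ^ m) → Fin (b ^ m) := fun n => ⟨f (k * b ^ m + n) % b ^ m, Nat.mod_lt _ hpos⟩
  have hg : ∀ n, k' * b ^ m + (g n : ℕ) = f (k * b ^ m + n) := fun n => by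
    rw [← hdiv n]
    exact Nat.div_add_mod' _ _
  have hginj : Function.Injective g := fun n n' h => by
    have h1 : f (k * b ^ m + n) = f (k * b ^ m + n') := by rw [← hg, ← hg, h]
    have h2 := hf.injective h1
    exact Fin.ext (by omega)
  have hgbij : Function.Bijective g := Finite.injective_iff_bijective.1 hginj
  have hnet := (hx.2 k' m hm).2.2 e a ha he
  rw [← hnet, ← Set.ncard_image_of_injective _ hginj]
  congr 1
  ext n
  obtain ⟨n, rfl⟩ := hgbij.2 n
  simp only [Set.mem_image, Set.mem_ofPred_eq, hginj.eq_iff, exists_eq_right, hg]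

lemma IsAdmissible.of_digits_add {d : ℕ} {x z : ℕ → Fin s → ℝ} (hx : IsAdmissible b d x)
    {v : Fin s → ℕ → Fin b}
    (h : ∀ n i j, Real.digits (z n i) b j = Real.digits (x n i) b j + v i j) :
    IsAdmissible b d z := by
  intro n k hkn
  have : pointDist b (z n) (z k) = pointDist b (x n) (x k) := by
    simp only [pointDist, h, add_sub_add_right_eq_sub]
  rw [this]
  exact hx n k hkn

/-- A digital shift permutes the elementary intervals of given side lengths. -/
lemma IsTSSequence.of_digits_add (hb : 2 ≤ b) {t : ℕ} {x z : ℕ → Fin s → ℝ}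
    (hx : IsTSSequence b t x) {v : Fin s → ℕ → Fin b} (hz : ∀ n i, z n i ∈ Set.Ico (0 : ℝ) 1)
    (h : ∀ n i j, Real.digits (z n i) b j = Real.digits (x n i) b j + v i j) :
    IsTSSequence b t z := by
  refine ⟨hz, fun k m hm => ⟨hm, fun n i => hz _ i, fun e a ha he => ?_⟩⟩
  let a' : Fin s → ℕ := fun i =>
    ∑ l ∈ Finset.range (e i), ((natDigit b (a i) l - v i (e i - 1 - l) : Fin b) : ℕ) * b ^ l
  have ha' : ∀ i, a' i < b ^ e i := fun i =>
    sum_digits_lt (fun l => natDigit b (a i) l - v i (e i - 1 - l)) _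
  rw [← (hx.2 k m hm).2.2 e a' ha' he]
  congr 1
  ext n
  simp only [elemInterval, Set.mem_ofPred_eq]
  refine forall_congr' fun i => ?_
  rw [mem_Ico_iff_digits hb (hz _ i) (ha i), mem_Ico_iff_digits hb (hx.1 _ i) (ha' i)]
  refine forall_congr' fun j => imp_congr_right fun hj => ?_
  rw [natDigit_sum (fun l => natDigit b (a i) l - v i (e i - 1 - l)), if_pos (by omega), h,
    show e i - 1 - (e i - 1 - j) = j by omega, eq_sub_iff_add_eq]

end Transfer

/-! ### The local discrepancy at a suitable corner -/

section Discrepancy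

/-- The integer `1 + b ^ D + ⋯ + b ^ (D (a - 1))`, whose base-`b` digits are `1` at the `a` lowest
multiples of `D` and `0` elsewhere. -/
def repunit (b D : ℕ) : ℕ → ℕ
  | 0 => 0
  | a + 1 => b ^ D * repunit b D a + 1

/-- The number `b ^ (-D) + b ^ (-2 D) + ⋯ + b ^ (-a D)`. -/
noncomputable def corner (b D a : ℕ) : ℝ := (repunit b D a : ℝ) / (b : ℝ) ^ (D * a)

variable {b : ℕ}

lemma repunit_lt (hb : 2 ≤ b) {D : ℕ} (hD : 1 ≤ D) (a : ℕ) : repunit b D a < b ^ (D * a) := by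
  induction a with
  | zero => simp [repunit]
  | succ a ih =>
    have h2 : 2 ≤ b ^ D := hb.trans (Nat.le_self_pow (by omega) b)
    have h3 : b ^ D * (repunit b D a + 1) ≤ b ^ D * b ^ (D * a) := Nat.mul_le_mul_left _ ih
    rw [repunit, Nat.mul_succ, pow_add, mul_comm (b ^ (D * a))]
    linarith

lemma corner_succ (hb : 2 ≤ b) (D a : ℕ) :
    corner b D (a + 1) = corner b D a + ((b : ℝ) ^ (D * (a + 1)))⁻¹ := by
  have hb0 : (0 : ℝ) < b := by exact_mod_cast (by omega : 0 < b)
  rw [corner, corner, repunit, Nat.mul_succ, pow_add]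
  push_cast
  field_simp

lemma corner_mono (hb : 2 ≤ b) (D : ℕ) : Monotone (corner b D) :=
  monotone_nat_of_le_succ fun a => by
    rw [corner_succ hb]
    exact le_add_of_nonneg_right (by positivity)

lemma corner_add_antitone (hb : 2 ≤ b) {D : ℕ} (hD : 1 ≤ D) :
    Antitone fun a => corner b D a + ((b : ℝ) ^ (D * a))⁻¹ :=
  antitone_nat_of_succ_le fun a => by
    have hb0 : (0 : ℝ) < b := by exact_mod_cast (by omega : 0 < b)
    have h2 : (2 : ℝ) ≤ (b : ℝ) ^ D := by
      exact_mod_cast hb.trans (Nat.le_self_pow (by omega) b)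
    have h3 : 2 * ((b : ℝ) ^ (D * (a + 1)))⁻¹ ≤ ((b : ℝ) ^ (D * a))⁻¹ := by
      rw [Nat.mul_succ, pow_add, mul_inv, mul_comm 2, mul_assoc]
      refine mul_le_of_le_one_right (by positivity) ?_
      rw [inv_mul_le_iff₀ (by positivity)]
      linarith
    rw [corner_succ hb]
    linarith

lemma corner_zero (b D : ℕ) : corner b D 0 = 0 := by simp [corner, repunit]

lemma corner_pos (hb : 2 ≤ b) (D : ℕ) {a : ℕ} (ha : 1 ≤ a) : 0 < corner b D a := by
  have hb0 : (0 : ℝ) < b := by exact_mod_cast (by omega : 0 < b)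
  refine lt_of_lt_of_le ?_ (corner_mono hb D ha)
  rw [corner_succ hb, corner_zero]
  positivity

lemma corner_le_one (hb : 2 ≤ b) {D : ℕ} (hD : 1 ≤ D) (a : ℕ) : corner b D a ≤ 1 := by
  have h := corner_add_antitone hb hD (Nat.zero_le a)
  have h0 : (0 : ℝ) ≤ ((b : ℝ) ^ (D * a))⁻¹ := by positivity
  simp only [corner_zero, mul_zero, pow_zero, inv_one, zero_add] at h
  linarith

/-- The half-open interval `[0, corner M)` is the disjoint union of the elementary intervals
`[corner a, corner (a + 1))`, `a < M`. -/
lemma indicator_corner (hb : 2 ≤ b) (D M : ℕ) (y : ℝ) :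
    (if y ∈ Set.Ico 0 (corner b D M) then 1 else 0 : ℝ) =
      ∑ a ∈ Finset.range M,
        if y ∈ Set.Ico (corner b D a) (corner b D (a + 1)) then 1 else 0 := by
  induction M with
  | zero => simp [corner_zero]
  | succ M ih =>
    rw [Finset.sum_range_succ, ← ih]
    have h0 : 0 ≤ corner b D M := by
      rw [← corner_zero b D]
      exact corner_mono hb D (Nat.zero_le M)
    have h1 := corner_mono hb D (Nat.le_succ M)
    simp only [Set.mem_Ico]
    rcases lt_or_ge y (corner b D M) with h | h
    · have h2 : y < corner b D (M + 1) := h.trans_le h1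
      have h3 : ¬ corner b D M ≤ y := not_le.2 h
      simp [h, h2, h3]
    · have h2 : 0 ≤ y := h0.trans h
      have h3 : ¬ y < corner b D M := not_lt.2 h
      simp [h, h2, h3]

open Classical in
lemma localDisc_eq_sum (hb : 2 ≤ b) {s : ℕ} (z : ℕ → Fin s → ℝ) (N D M : ℕ) :
    localDisc z N (fun _ => corner b D M) =
      ∑ p ∈ Fintype.piFinset fun _ : Fin s => Finset.range M,
        (∑ n ∈ Finset.range N,
          (if ∀ i, z n i ∈ Set.Ico (corner b D (p i)) (corner b D (p i + 1)) then 1 else 0 : ℝ) -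
        N * ∏ i, ((b : ℝ) ^ (D * (p i + 1)))⁻¹) := by
  have hvol : corner b D M = ∑ a ∈ Finset.range M, ((b : ℝ) ^ (D * (a + 1)))⁻¹ := by
    induction M with
    | zero => simp [corner_zero]
    | succ M ih => rw [Finset.sum_range_succ, ← ih, corner_succ hb]
  have hcount : (({n : ℕ | n < N ∧ ∀ i, z n i ∈ Set.Ico 0 (corner b D M)}.ncard : ℕ) : ℝ) =
      ∑ n ∈ Finset.range N, ∏ i, if z n i ∈ Set.Ico 0 (corner b D M) then (1 : ℝ) else 0 := by
    have : {n : ℕ | n < N ∧ ∀ i, z n i ∈ Set.Ico 0 (corner b D M)} =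
        ((Finset.range N).filter fun n => ∀ i, z n i ∈ Set.Ico 0 (corner b D M) : Finset ℕ) := by
      ext n
      simp
    rw [this, Set.ncard_coe_finset, Finset.card_filter]
    push_cast
    refine Finset.sum_congr rfl fun n _ => ?_
    rw [Finset.prod_ite_zero]
    simp
  rw [localDisc, hcount, Finset.sum_sub_distrib, Finset.sum_comm, ← Finset.mul_sum]
  congr 1
  · refine Finset.sum_congr rfl fun n _ => ?_
    simp only [indicator_corner hb]
    rw [Finset.prod_univ_sum]
    refine Finset.sum_congr rfl fun p _ => ?_
    rw [Finset.prod_ite_zero]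
    simp
  · rw [hvol, Finset.prod_univ_sum]

open Classical in
lemma IsTSSequence.sum_indicator {s t : ℕ} {z : ℕ → Fin s → ℝ} (hz : IsTSSequence b t z)
    {e a : Fin s → ℕ} (ha : ∀ i, a i < b ^ e i) (K : ℕ) :
    ∑ n ∈ Finset.range (K * b ^ (∑ i, e i + t)), (if z n ∈ elemInterval b e a then 1 else 0 : ℝ) =
      K * (b : ℝ) ^ t := by
  induction K with
  | zero => simp
  | succ K ih =>
    rw [Nat.succ_mul, Finset.sum_range_add, ih, Finset.sum_range]
    have h := (hz.2 K _ (Nat.le_add_left t (∑ i, e i))).2.2 e a ha rfl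
    rw [Finset.sum_boole, ← Nat.cast_pow b t, ← h, Set.ncard_eq_toFinset_card']
    simp only [Set.toFinset_ofPred]
    push_cast
    ring

lemma elemInterval_corner (hb : 2 ≤ b) {s : ℕ} (D : ℕ) (p : Fin s → ℕ) (y : Fin s → ℝ) :
    y ∈ elemInterval b (fun i => D * (p i + 1)) (fun i => b ^ D * repunit b D (p i)) ↔
      ∀ i, y i ∈ Set.Ico (corner b D (p i)) (corner b D (p i + 1)) := by
  have hb0 : (0 : ℝ) < b := by exact_mod_cast (by omega : 0 < b)
  simp only [elemInterval, Set.mem_ofPred_eq]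
  refine forall_congr' fun i => ?_
  have h1 : ((b ^ D * repunit b D (p i) : ℕ) : ℝ) / (b : ℝ) ^ (D * (p i + 1)) =
      corner b D (p i) := by
    rw [corner, Nat.mul_succ, pow_add]
    push_cast
    field_simp
  have h2 : (((b ^ D * repunit b D (p i) : ℕ) : ℝ) + 1) / (b : ℝ) ^ (D * (p i + 1)) =
      corner b D (p i + 1) := by
    rw [corner, repunit]
    push_cast
    rfl
  rw [h1, h2]

variable [NeZero b]

/-- If `y` starts with the first `D M` digits of `corner M`, then every `x` in the interval number
`a` of the decomposition of `[0, corner M)` shares at least `D (a + 1) - 1` digits with `y`. -/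
lemma digitNorm_sub_le_of_mem (hb : 2 ≤ b) {D M a : ℕ} (hD : 1 ≤ D) (ha : a < M) {x y : ℝ}
    (hx1 : x ∈ Set.Ico (0 : ℝ) 1) (hy1 : y ∈ Set.Ico (0 : ℝ) 1)
    (hx : x ∈ Set.Ico (corner b D a) (corner b D (a + 1)))
    (hy : y ∈ Set.Ico (corner b D M) (corner b D M + ((b : ℝ) ^ (D * M))⁻¹)) :
    digitNorm (fun j => Real.digits y b j - Real.digits x b j) ≤
      ((b : ℝ) ^ (D * (a + 1)))⁻¹ := by
  have hb0 : (0 : ℝ) < b := by exact_mod_cast NeZero.pos b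
  have hb2 : (2 : ℝ) ≤ b := by exact_mod_cast hb
  have hDa : D * a + (D - 1) + 1 = D * (a + 1) := by rw [Nat.mul_succ]; omega
  have hc : b ^ (D - 1) * repunit b D a < b ^ (D * a + (D - 1)) := by
    rw [pow_add, mul_comm]
    exact Nat.mul_lt_mul_of_pos_right (repunit_lt hb hD a) (pow_pos (NeZero.pos b) _)
  have hl : ((b ^ (D - 1) * repunit b D a : ℕ) : ℝ) / (b : ℝ) ^ (D * a + (D - 1)) =
      corner b D a := by
    rw [corner, pow_add]
    push_cast
    field_simp
  have hr : (((b ^ (D - 1) * repunit b D a : ℕ) : ℝ) + 1) / (b : ℝ) ^ (D * a + (D - 1)) =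
      corner b D a + b * ((b : ℝ) ^ (D * (a + 1)))⁻¹ := by
    rw [add_div, hl, ← hDa, pow_succ]
    field_simp
  have hpos : (0 : ℝ) < ((b : ℝ) ^ (D * (a + 1)))⁻¹ := by positivity
  have h1 := corner_succ hb D a
  have h2 := corner_add_antitone hb hD (Nat.succ_le_of_lt ha)
  have h3 := corner_mono hb D ha.le
  simp only [Nat.succ_eq_add_one] at h2
  have hx' := (mem_Ico_iff_digits hb hx1 hc).1 (by
    rw [hl, hr]
    exact ⟨hx.1, hx.2.trans_le (by nlinarith)⟩)
  have hy' := (mem_Ico_iff_digits hb hy1 hc).1 (by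
    rw [hl, hr]
    exact ⟨h3.trans hy.1, hy.2.trans_le (by nlinarith)⟩)
  rw [← hDa]
  exact digitNorm_le hb fun j hj => by rw [hx' j hj, hy' j hj, sub_self]

open Classical in
/-- One box of the decomposition of `[0, corner M) ^ s`, of volume `b ^ (-D (S + 1))`. Up to the
largest multiple `P` of `b ^ (t + D (S + 1))` up to `N` the box contains exactly the expected number
of points, by the net property; from `P` on it contains no point, because such a point would be too
close to the point number `N`. -/
lemma box_disc_le (hb : 2 ≤ b) {s d t : ℕ} (hs : 1 ≤ s) {z : ℕ → Fin s → ℝ}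
    (hz : IsTSSequence b t z) (hadm : IsAdmissible b d z) {D M N : ℕ} (hD : D = d + t + 1)
    (hN : ∀ S, S < s * M → (b - 1) * b ^ (t + D * S) ≤ N % b ^ (t + D * (S + 1)) ∧
      N % b ^ (t + D * (S + 1)) < b ^ (t + D * S + 1))
    (hzN : ∀ i, z N i ∈ Set.Ico (corner b D M) (corner b D M + ((b : ℝ) ^ (D * M))⁻¹))
    (p : Fin s → ℕ) (hp : ∀ i, p i < M) :
    ∑ n ∈ Finset.range N,
        (if ∀ i, z n i ∈ Set.Ico (corner b D (p i)) (corner b D (p i + 1)) then 1 else 0 : ℝ) -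
      N * ∏ i, ((b : ℝ) ^ (D * (p i + 1)))⁻¹ ≤ -(((b : ℝ) - 1) * ((b : ℝ) ^ (d + 1))⁻¹) := by
  have hb0 : (0 : ℝ) < b := by exact_mod_cast NeZero.pos b
  have hb2 : (2 : ℝ) ≤ b := by exact_mod_cast hb
  have hbpos : 0 < b := NeZero.pos b
  obtain ⟨S, hS⟩ : ∃ S, ∑ i, (p i + 1) = S + 1 := by
    refine Nat.exists_eq_add_one.2 ?_
    have : Nonempty (Fin s) := ⟨⟨0, hs⟩⟩
    exact Finset.sum_pos (fun i _ => Nat.succ_pos _) Finset.univ_nonempty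
  have hSM : S < s * M := by
    have : ∑ i, (p i + 1) ≤ ∑ _i : Fin s, M := Finset.sum_le_sum fun i _ => hp i
    rw [hS, Finset.sum_const, Finset.card_univ, Fintype.card_fin, smul_eq_mul] at this
    omega
  obtain ⟨hR1, hR2⟩ := hN S hSM
  have hE : ∑ i, D * (p i + 1) = D * (S + 1) := by rw [← Finset.mul_sum, hS]
  have hvol : ∏ i, ((b : ℝ) ^ (D * (p i + 1)))⁻¹ = ((b : ℝ) ^ (D * (S + 1)))⁻¹ := by
    rw [Finset.prod_inv_distrib, Finset.prod_pow_eq_pow_sum, hE]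
  set q := t + D * S with hq
  have hqE : t + D * (S + 1) = q + D := by rw [hq, Nat.mul_succ]; ring
  have hqd : D * (S + 1) = q + (d + 1) := by rw [hq, Nat.mul_succ, hD]; ring
  clear_value q
  set R := N % b ^ (t + D * (S + 1)) with hR
  set K := N / b ^ (t + D * (S + 1)) with hK
  have hNdec : N = K * b ^ (∑ i, D * (p i + 1) + t) + R := by
    rw [hE, add_comm _ t]
    exact (Nat.div_add_mod' N _).symm
  have hempty : ∀ r ∈ Finset.range R,
      (if ∀ i, z (K * b ^ (∑ i, D * (p i + 1) + t) + r) i ∈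
        Set.Ico (corner b D (p i)) (corner b D (p i + 1)) then 1 else 0 : ℝ) = 0 := by
    intro r hr
    rw [Finset.mem_range] at hr
    rw [if_neg]
    intro hmem
    set n := K * b ^ (∑ i, D * (p i + 1) + t) + r with hn
    have hdec : K * b ^ (∑ i, D * (p i + 1) + t) = b ^ (q + 1) * (b ^ (d + t) * K) := by
      rw [hE, add_comm _ t, hqE, hD, ← mul_assoc, ← pow_add, mul_comm K]
      congr 2
      ring
    have hblock : N / b ^ (q + 1) = n / b ^ (q + 1) := by
      have hpos : 0 < b ^ (q + 1) := by positivity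
      rw [hn, hNdec, hdec, Nat.mul_add_div hpos, Nat.mul_add_div hpos, Nat.div_eq_of_lt hR2,
        Nat.div_eq_of_lt (hr.trans hR2)]
    have hlt : n < N := by omega
    have hnorm := natNorm_natSub_le hb hblock
    have hdist : pointDist b (z N) (z n) ≤ ((b : ℝ) ^ (D * (S + 1)))⁻¹ := by
      rw [← hvol]
      exact Finset.prod_le_prod (fun i _ => digitNorm_nonneg _) fun i _ =>
        digitNorm_sub_le_of_mem hb (by omega) (hp i) (hz.1 n i) (hz.1 N i) (hmem i) (hzN i)
    have hdist0 : 0 ≤ pointDist b (z N) (z n) :=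
      Finset.prod_nonneg fun i _ => digitNorm_nonneg _
    have h1 := (hadm N n hlt).trans (mul_le_mul hnorm hdist hdist0 (by positivity))
    have h2 : (b : ℝ) ^ q * ((b : ℝ) ^ (D * (S + 1)))⁻¹ = ((b : ℝ) ^ (d + 1))⁻¹ := by
      rw [hqd, pow_add]
      field_simp
    rw [h2] at h1
    have h3 : ((b : ℝ) ^ (d + 1))⁻¹ < ((b : ℝ) ^ d)⁻¹ := by
      apply inv_strictAnti₀ (by positivity)
      exact pow_lt_pow_right₀ (by linarith) (Nat.lt_succ_self d)
    linarith
  have hcount : ∑ n ∈ Finset.range N,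
      (if ∀ i, z n i ∈ Set.Ico (corner b D (p i)) (corner b D (p i + 1)) then 1 else 0 : ℝ) =
      K * (b : ℝ) ^ t := by
    rw [hNdec, Finset.sum_range_add, Finset.sum_eq_zero hempty, add_zero]
    have ha : ∀ i, b ^ D * repunit b D (p i) < b ^ (D * (p i + 1)) := fun i => by
      have := repunit_lt hb (D := D) (by omega) (p i + 1)
      rw [repunit] at this
      omega
    rw [← hz.sum_indicator ha K]
    simp only [elemInterval_corner hb]
  have hNreal : (N : ℝ) = K * (b : ℝ) ^ (D * (S + 1) + t) + R := by
    conv_lhs => rw [hNdec, hE]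
    push_cast
    ring
  have hRreal : ((b : ℝ) - 1) * (b : ℝ) ^ q ≤ R := by
    have : (((b - 1) * b ^ q : ℕ) : ℝ) ≤ R := by exact_mod_cast hR1
    rwa [Nat.cast_mul, Nat.cast_sub (by omega), Nat.cast_pow, Nat.cast_one] at this
  rw [hcount, hvol, hNreal]
  have h1 : (K : ℝ) * (b : ℝ) ^ t - (K * (b : ℝ) ^ (D * (S + 1) + t) + R) *
      ((b : ℝ) ^ (D * (S + 1)))⁻¹ = -(R * ((b : ℝ) ^ (D * (S + 1)))⁻¹) := by
    rw [pow_add]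
    field_simp
    ring
  have h2 : ((b : ℝ) - 1) * ((b : ℝ) ^ (d + 1))⁻¹ =
      (((b : ℝ) - 1) * (b : ℝ) ^ q) * ((b : ℝ) ^ (D * (S + 1)))⁻¹ := by
    rw [hqd, pow_add (b : ℝ) q]
    field_simp
  rw [h1, h2, neg_le_neg_iff]
  exact mul_le_mul_of_nonneg_right hRreal (by positivity)

/-- If the point number `N` starts with the digits of `(corner M, …, corner M)`, and `N` has the
digit `b - 1` at the indices `t + D S`, `S < s M`, and the digit `0` between them, then every one
of the `M ^ s` boxes contains noticeably too few of the first `N` points. -/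
lemma localDisc_corner_le (hb : 2 ≤ b) {s d t : ℕ} (hs : 1 ≤ s) {z : ℕ → Fin s → ℝ}
    (hz : IsTSSequence b t z) (hadm : IsAdmissible b d z) {D M N : ℕ} (hD : D = d + t + 1)
    (hN : ∀ S, S < s * M → (b - 1) * b ^ (t + D * S) ≤ N % b ^ (t + D * (S + 1)) ∧
      N % b ^ (t + D * (S + 1)) < b ^ (t + D * S + 1))
    (hzN : ∀ i, z N i ∈ Set.Ico (corner b D M) (corner b D M + ((b : ℝ) ^ (D * M))⁻¹)) :
    localDisc z N (fun _ => corner b D M) ≤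
      -((M : ℝ) ^ s * (((b : ℝ) - 1) * ((b : ℝ) ^ (d + 1))⁻¹)) := by
  classical
  rw [localDisc_eq_sum hb]
  refine (Finset.sum_le_card_nsmul _ _ _ fun p hp =>
    box_disc_le hb hs hz hadm hD hN hzN p fun i => ?_).trans_eq ?_
  · simpa using Fintype.mem_piFinset.1 hp i
  · rw [Fintype.card_piFinset]
    simp

omit [NeZero b] in
lemma abs_localDisc_le {s : ℕ} (z : ℕ → Fin s → ℝ) {N : ℕ} (hN : 1 ≤ N) {y : Fin s → ℝ}
    (hy : ∀ i, 0 < y i ∧ y i ≤ 1) : |localDisc z N y| ≤ N * starDisc z N := by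
  have hN0 : (0 : ℝ) < N := by exact_mod_cast hN
  have hbdd : BddAbove (Set.range fun y : {y : Fin s → ℝ // ∀ i, 0 < y i ∧ y i ≤ 1} =>
      |1 / (N : ℝ) * localDisc z N y.1|) := by
    refine ⟨1 / (N : ℝ) * N, ?_⟩
    rintro _ ⟨⟨y, hy⟩, rfl⟩
    simp only
    rw [abs_mul, abs_of_nonneg (by positivity : (0 : ℝ) ≤ 1 / N)]
    refine mul_le_mul_of_nonneg_left ?_ (by positivity)
    have h1 : (({n : ℕ | n < N ∧ ∀ i, z n i ∈ Set.Ico 0 (y i)}.ncard : ℕ) : ℝ) ≤ N := by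
      have : {n : ℕ | n < N ∧ ∀ i, z n i ∈ Set.Ico 0 (y i)}.ncard ≤ (Finset.range N : Set ℕ).ncard :=
        Set.ncard_le_ncard (fun n hn => by simpa using hn.1) (Finset.finite_toSet _)
      rw [Set.ncard_coe_finset, Finset.card_range] at this
      exact_mod_cast this
    have h2 : ∏ i, y i ≤ 1 := Finset.prod_le_one (fun i _ => (hy i).1.le) fun i _ => (hy i).2
    have h3 : 0 ≤ ∏ i, y i := Finset.prod_nonneg fun i _ => (hy i).1.le
    have h4 : (0 : ℝ) ≤ (({n : ℕ | n < N ∧ ∀ i, z n i ∈ Set.Ico 0 (y i)}.ncard : ℕ) : ℝ) :=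
      Nat.cast_nonneg _
    rw [localDisc, abs_le]
    constructor <;> nlinarith
  have h := le_ciSup hbdd ⟨y, hy⟩
  simp only at h
  have h' := mul_le_mul_of_nonneg_left h hN0.le
  refine le_trans (le_of_eq ?_) h'
  rw [abs_mul, abs_of_nonneg (by positivity : (0 : ℝ) ≤ 1 / N)]
  field_simp

end Discrepancy

/-! ### Index permutations of unitriangular matrices -/

section IndexMap

variable {b : ℕ} [NeZero b] {F : Type*} [Field F] {φ : Fin b ≃ F} {C : Matrix ℕ ℕ F}

lemma indexMap_eq_sum (φ : Fin b ≃ F) (C : Matrix ℕ ℕ F) (m n : ℕ) :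
    indexMap φ C m n = ∑ j ∈ Finset.range m,
      (φ.symm (∑ r ∈ Finset.range m, C j r * φ (natDigit b n r)) : ℕ) * b ^ j := by
  rw [indexMap, Finset.sum_range]
  refine Finset.sum_congr rfl fun j _ => ?_
  rw [Finset.sum_range]
  simp [Matrix.vecMul, dotProduct, leadBlock, mul_comm]

lemma natDigit_indexMap (m n j : ℕ) : natDigit b (indexMap φ C m n) j =
    if j < m then φ.symm (∑ r ∈ Finset.range m, C j r * φ (natDigit b n r)) else 0 := by
  rw [indexMap_eq_sum,
    natDigit_sum fun j => φ.symm (∑ r ∈ Finset.range m, C j r * φ (natDigit b n r))]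

lemma indexMap_lt (m n : ℕ) : indexMap φ C m n < b ^ m := by
  rw [indexMap_eq_sum]
  exact sum_digits_lt (fun j => φ.symm (∑ r ∈ Finset.range m, C j r * φ (natDigit b n r))) m

lemma indexMap_div_eq_iff (hb : 2 ≤ b) (hC1 : ∀ j, C j j = 1) (hC0 : ∀ j r, r < j → C j r = 0)
    {m n k : ℕ} (hn : n < b ^ m) (hk : k < b ^ m) (q : ℕ) :
    indexMap φ C m n / b ^ q = indexMap φ C m k / b ^ q ↔ n / b ^ q = k / b ^ q := by
  constructor
  · intro h
    by_contra hne
    obtain ⟨p, hp1, hp2⟩ := exists_top_digit hb (fun h : n = k => hne (by rw [h]))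
    have hqp : q ≤ p := by
      by_contra hlt
      refine hne ((div_pow_eq_iff hb).2 fun j hj => ?_)
      exact (div_pow_eq_iff hb).1 hp1 j (by omega)
    have hpm : p < m := by
      by_contra hge
      refine hp2 ?_
      have : b ^ m ≤ b ^ p := Nat.pow_le_pow_right (by omega) (not_lt.1 hge)
      rw [Nat.div_eq_of_lt (by omega), Nat.div_eq_of_lt (by omega)]
    have hdig : natDigit b n p = natDigit b k p := by
      have h1 := (div_pow_eq_iff hb).1 h p hqp
      rw [natDigit_indexMap, natDigit_indexMap, if_pos hpm, if_pos hpm,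
        φ.symm.injective.eq_iff, ← sub_eq_zero, ← Finset.sum_sub_distrib,
        Finset.sum_eq_single p] at h1
      · rw [hC1, one_mul, one_mul, sub_eq_zero, φ.injective.eq_iff] at h1
        exact h1
      · intro r _ hr
        rcases lt_or_gt_of_ne hr with hr | hr
        · rw [hC0 p r hr]
          ring
        · rw [(div_pow_eq_iff hb).1 hp1 r hr]
          ring
      · intro hr
        exact absurd (Finset.mem_range.2 hpm) hr
    refine hp2 ((div_pow_eq_iff hb).2 fun j hj => ?_)
    rcases hj.eq_or_lt with rfl | hj
    · exact hdig
    · exact (div_pow_eq_iff hb).1 hp1 j hj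
  · intro h
    refine (div_pow_eq_iff hb).2 fun j hj => ?_
    rw [natDigit_indexMap, natDigit_indexMap]
    split_ifs
    · congr 1
      refine Finset.sum_congr rfl fun r _ => ?_
      rcases lt_or_ge r j with hr | hr
      · rw [hC0 j r hr, zero_mul, zero_mul]
      · rw [(div_pow_eq_iff hb).1 h r (hj.trans hr)]
    · rfl

lemma indexMap_injOn (hb : 2 ≤ b) (hC1 : ∀ j, C j j = 1) (hC0 : ∀ j r, r < j → C j r = 0)
    (m : ℕ) : Set.InjOn (indexMap φ C m) (Set.Iio (b ^ m)) := by
  intro n hn k hk h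
  have := (indexMap_div_eq_iff hb hC1 hC0 hn hk 0 (φ := φ)).1 (by rw [h])
  simpa using this

lemma indexMapInv_spec (hb : 2 ≤ b) (hC1 : ∀ j, C j j = 1) (hC0 : ∀ j r, r < j → C j r = 0)
    {m n : ℕ} (hn : n < b ^ m) :
    indexMapInv φ C m n < b ^ m ∧ indexMap φ C m (indexMapInv φ C m n) = n := by
  have hsurj : Set.SurjOn (indexMap φ C m) (Finset.range (b ^ m)) (Finset.range (b ^ m)) := by
    refine Finset.surjOn_of_injOn_of_card_le _ (fun n _ => ?_) ?_ le_rfl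
    · simpa using indexMap_lt m n
    · simpa [Set.Iio_def] using indexMap_injOn (φ := φ) hb hC1 hC0 m
  obtain ⟨a, ha, han⟩ := hsurj (by simpa using hn : n ∈ (Finset.range (b ^ m) : Set ℕ))
  have hex : ∃ a ∈ Set.Iio (b ^ m), indexMap φ C m a = n := ⟨a, by simpa using ha, han⟩
  exact ⟨Function.invFunOn_mem hex, Function.invFunOn_eq hex⟩

lemma indexMapInv_eq (hb : 2 ≤ b) (hC1 : ∀ j, C j j = 1) (hC0 : ∀ j r, r < j → C j r = 0)
    {m n : ℕ} (hn : n < b ^ m) : indexMapInv φ C m (indexMap φ C m n) = n := by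
  have h := indexMapInv_spec (φ := φ) hb hC1 hC0 (indexMap_lt (φ := φ) (C := C) m n)
  exact indexMap_injOn hb hC1 hC0 m h.1 hn h.2

lemma indexMap_eq_of_le (hb : 2 ≤ b) (hφ : φ 0 = 0) (hC0 : ∀ j r, r < j → C j r = 0)
    {m m' n : ℕ} (hm : m ≤ m') (hn : n < b ^ m) : indexMap φ C m' n = indexMap φ C m n := by
  have hφ' : φ.symm 0 = 0 := by rw [← hφ, Equiv.symm_apply_apply]
  have hsum : ∀ j, ∑ r ∈ Finset.range m', C j r * φ (natDigit b n r) =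
      ∑ r ∈ Finset.range m, C j r * φ (natDigit b n r) := fun j => by
    refine (Finset.sum_subset (Finset.range_mono hm) fun r _ hr => ?_).symm
    rw [natDigit_eq_zero_of_lt hb hn (by simpa using hr), hφ, mul_zero]
  refine eq_of_natDigit_eq hb fun j => ?_
  rw [natDigit_indexMap, natDigit_indexMap, hsum]
  by_cases hj : j < m
  · rw [if_pos hj, if_pos (hj.trans_le hm)]
  · rw [if_neg hj, ite_eq_right_iff]
    intro _
    rw [Finset.sum_eq_zero, hφ']
    intro r hr
    rw [hC0 j r (by have := Finset.mem_range.1 hr; omega), zero_mul]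

lemma indexMapInv_eq_of_le (hb : 2 ≤ b) (hφ : φ 0 = 0) (hC1 : ∀ j, C j j = 1)
    (hC0 : ∀ j r, r < j → C j r = 0) {m m' n : ℕ} (hm : m ≤ m') (hn : n < b ^ m) :
    indexMapInv φ C m' n = indexMapInv φ C m n := by
  have h := indexMapInv_spec (φ := φ) hb hC1 hC0 hn
  have h1 := indexMap_eq_of_le hb hφ hC0 hm h.1
  rw [h.2] at h1
  have hle : b ^ m ≤ b ^ m' := Nat.pow_le_pow_right (by omega) hm
  conv_lhs => rw [← h1]
  exact indexMapInv_eq hb hC1 hC0 (h.1.trans_le hle)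

/-- The maps `indexMapInv φ C m`, which extend one another, glue to a block-preserving map. -/
lemma exists_indexMapInv_glue (hb : 2 ≤ b) (hφ : φ 0 = 0) (hC1 : ∀ j, C j j = 1)
    (hC0 : ∀ j r, r < j → C j r = 0) :
    ∃ h : ℕ → ℕ, BlockPreserving b h ∧ ∀ m n, n < b ^ m → h n = indexMapInv φ C m n := by
  have hself : ∀ n, n < b ^ n := fun n => Nat.lt_pow_self (by omega)
  have hglue : ∀ m n, n < b ^ m → indexMapInv φ C n n = indexMapInv φ C m n := fun m n hn => by
    rcases le_total m n with h | h
    · exact indexMapInv_eq_of_le hb hφ hC1 hC0 h hn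
    · exact (indexMapInv_eq_of_le hb hφ hC1 hC0 h (hself n)).symm
  refine ⟨fun n => indexMapInv φ C n n, fun q n k => ?_, hglue⟩
  have hn : n < b ^ (n + k) := by have := hself (n + k); omega
  have hk : k < b ^ (n + k) := by have := hself (n + k); omega
  have h1 := indexMapInv_spec (φ := φ) hb hC1 hC0 hn
  have h2 := indexMapInv_spec (φ := φ) hb hC1 hC0 hk
  simp only
  rw [hglue _ n hn, hglue _ k hk, ← indexMap_div_eq_iff hb hC1 hC0 h1.1 h2.1 q (φ := φ), h1.2, h2.2]

omit [NeZero b] in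
lemma isUnit_leadBlock (hC1 : ∀ j, C j j = 1) (hC0 : ∀ j r, r < j → C j r = 0) (m : ℕ) :
    IsUnit (leadBlock C m) := by
  rw [Matrix.isUnit_iff_isUnit_det, Matrix.det_of_isUpperTriangular]
  · simp [leadBlock, hC1]
  · intro i j hij
    exact hC0 _ _ hij

end IndexMap

/-! ### The additional generating matrix -/

section Selection

variable {F : Type*} [Field F]

/-- In a long enough range of columns one can choose `J` columns outside of a set `T` of columns
that spans the column space of the range. -/
lemma exists_selection {ι : Type*} [Fintype ι] (X : ℕ → ι → F) {L m J : ℕ}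
    (h : L + Fintype.card ι + J ≤ m) :
    ∃ (T : Finset ℕ) (f : ℕ → ℕ), T ⊆ Finset.Ico L m ∧
      (∀ r ∈ Finset.Ico L m, X r ∈ Submodule.span F (X '' T)) ∧
      Set.InjOn f (Set.Iio J) ∧ ∀ j, j < J → f j ∈ Finset.Ico L m \ T := by
  classical
  obtain ⟨T', hT', -, hspan, hli⟩ := exists_linearIndepOn_extension (K := F) (v := X)
    (linearIndepOn_empty F X) (Set.empty_subset (Finset.Ico L m : Set ℕ))
  have hfin : T'.Finite := (Finset.finite_toSet _).subset hT'
  obtain ⟨T, rfl⟩ := hfin.exists_finset_coe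
  have hTcard : T.card ≤ Fintype.card ι := by
    have := LinearIndependent.fintype_card_le_finrank hli
    simpa using this
  have hTsub : T ⊆ Finset.Ico L m := by exact_mod_cast hT'
  have hcard : J ≤ (Finset.Ico L m \ T).card := by
    rw [Finset.card_sdiff_of_subset hTsub, Nat.card_Ico]
    omega
  obtain ⟨U, hU, hUcard⟩ := Finset.exists_subset_card_eq hcard
  refine ⟨T, fun j => if hj : j < J then U.orderEmbOfFin hUcard ⟨j, hj⟩ else 0, hTsub,
    fun r hr => hspan ⟨r, by simpa using hr, rfl⟩, ?_, ?_⟩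
  · intro j hj k hk hjk
    rw [Set.mem_Iio] at hj hk
    simp only [dif_pos hj, dif_pos hk, EmbeddingLike.apply_eq_iff_eq, Fin.mk.injEq] at hjk
    exact hjk
  · intro j hj
    simp only [dif_pos hj]
    exact hU (Finset.orderEmbOfFin_mem U hUcard _)

/-- Simultaneous solution of the systems `X v = A` and `C u = B`, where `u r = σ r (v r)` for
arbitrary permutations `σ r` of the field. The unknowns below `J` make the first system solvable
(modulo the span of the columns in `T`), the unknowns with indices `f j` then solve the second
system, and the unknowns with indices in `T`, which do not occur in the second system, correct the
first one. -/
lemma exists_solution {ι : Type*} {X : ℕ → ι → F} {C : Matrix ℕ ℕ F} {J L m : ℕ}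
    (hJL : J ≤ L) (hLm : L ≤ m) {T : Finset ℕ} {f : ℕ → ℕ} (hT : T ⊆ Finset.Ico L m)
    (hspan : ∀ r ∈ Finset.Ico L m, X r ∈ Submodule.span F (X '' T))
    (hinj : Set.InjOn f (Set.Iio J)) (hf : ∀ j, j < J → f j ∈ Finset.Ico L m \ T)
    (hC : ∀ j, j < J → ∀ r ∈ Finset.Ico L m, C j r = if f j = r then 1 else 0)
    (hlow : ∀ A : ι → F, ∃ v : ℕ → F, ∑ r ∈ Finset.range J, v r • X r = A)
    (σ : ℕ → Equiv.Perm F) (A : ι → F) (B : ℕ → F) :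
    ∃ v : ℕ → F, ∑ r ∈ Finset.range m, v r • X r = A ∧
      ∀ j, j < J → ∑ r ∈ Finset.range m, C j r * σ r (v r) = B j := by
  classical
  obtain ⟨v₀, hv₀⟩ := hlow A
  let v₁ : ℕ → F := fun r => if r < J then v₀ r else 0
  let β : ℕ → F := fun j => B j - ∑ r ∈ Finset.range L, C j r * σ r (v₁ r)
  let w : ℕ → F := fun r =>
    if r ∈ f '' Set.Iio J then (σ r).symm (β (Function.invFunOn f (Set.Iio J) r)) else 0
  have hw : ∀ j, j < J → σ (f j) (w (f j)) = β j := fun j hj => by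
    have hmem : f j ∈ f '' Set.Iio J := ⟨j, hj, rfl⟩
    simp only [w, if_pos hmem, Equiv.apply_symm_apply, hinj.leftInvOn_invFunOn hj]
  have hmem : -∑ r ∈ Finset.Ico L m \ T, w r • X r ∈ Submodule.span F (X '' T) :=
    Submodule.neg_mem _ (Submodule.sum_mem _ fun r hr =>
      Submodule.smul_mem _ _ (hspan r (Finset.sdiff_subset hr)))
  obtain ⟨c, hc⟩ := (Submodule.mem_span_image_finset_iff_exists_fun' F).1 hmem
  let v : ℕ → F := fun r => if r < L then v₁ r else if r ∈ T then c r else w r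
  have hvlow : ∀ r ∈ Finset.range L, v r = v₁ r := fun r hr => if_pos (Finset.mem_range.1 hr)
  have hvT : ∀ r ∈ T, v r = c r := fun r hr => by
    have : ¬ r < L := by have := Finset.mem_Ico.1 (hT hr); omega
    simp only [v, if_neg this, if_pos hr]
  have hvw : ∀ r ∈ Finset.Ico L m \ T, v r = w r := fun r hr => by
    obtain ⟨h1, h2⟩ := Finset.mem_sdiff.1 hr
    have : ¬ r < L := by have := Finset.mem_Ico.1 h1; omega
    simp only [v, if_neg this, if_neg h2]
  refine ⟨v, ?_, fun j hj => ?_⟩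
  · rw [← Finset.sum_range_add_sum_Ico _ hLm, ← Finset.sum_sdiff hT,
      Finset.sum_congr rfl fun r hr => by rw [hvlow r hr],
      Finset.sum_congr rfl fun r (hr : r ∈ Finset.Ico L m \ T) => by rw [hvw r hr],
      Finset.sum_congr rfl fun r (hr : r ∈ T) => by rw [hvT r hr], hc, add_neg_cancel, add_zero,
      ← hv₀]
    symm
    refine Finset.sum_subset_zero_on_sdiff (Finset.range_mono hJL) (fun r hr => ?_) fun r hr => ?_
    · have : ¬ r < J := by simpa using (Finset.mem_sdiff.1 hr).2
      simp only [v₁, if_neg this, zero_smul]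
    · simp only [v₁, if_pos (Finset.mem_range.1 hr)]
  · have h1 : ∑ r ∈ Finset.Ico L m, C j r * σ r (v r) = β j := by
      rw [Finset.sum_eq_single (f j)]
      · rw [hC j hj _ (Finset.sdiff_subset (hf j hj)), if_pos rfl, one_mul, hvw _ (hf j hj), hw j hj]
      · intro r hr hne
        rw [hC j hj r hr, if_neg hne.symm, zero_mul]
      · intro h
        exact absurd (Finset.sdiff_subset (hf j hj)) h
    rw [← Finset.sum_range_add_sum_Ico _ hLm, h1,
      Finset.sum_congr rfl fun r hr => by rw [hvlow r hr]]
    simp only [β]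
    ring

/-- A unitriangular `0`-`1` matrix whose rows `j < J k` have, in the columns from `L k` to `m k`,
the single entry `1` in the column `f k j`, for all `k ≥ 1`. -/
lemma exists_unitriangular {J L m : ℕ → ℕ} (f : ℕ → ℕ → ℕ) (hm : Monotone m)
    (hJL : ∀ k, 1 ≤ k → J k ≤ L k) (hmL : ∀ k, m k ≤ L (k + 1))
    (hf : ∀ k, 1 ≤ k → ∀ j, j < J k → f k j ∈ Finset.Ico (L k) (m k)) :
    ∃ C : Matrix ℕ ℕ F, (∀ j, C j j = 1) ∧ (∀ j r, r < j → C j r = 0) ∧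
      ∀ k, 1 ≤ k → ∀ j, j < J k → ∀ r ∈ Finset.Ico (L k) (m k),
        C j r = if f k j = r then 1 else 0 := by
  classical
  have hlt : ∀ k l, k < l → m k ≤ L l := fun k l hkl => by
    obtain ⟨l, rfl⟩ := Nat.exists_eq_add_one.2 (by omega : 0 < l)
    exact (hm (by omega)).trans (hmL l)
  refine ⟨fun j r => if j = r ∨ ∃ k, 1 ≤ k ∧ j < J k ∧ f k j = r then 1 else 0,
    fun j => if_pos (Or.inl rfl), fun j r hr => if_neg ?_, fun k hk j hj r hr => ?_⟩
  · rintro (rfl | ⟨k, hk, hj, rfl⟩)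
    · exact lt_irrefl _ hr
    · have h1 := Finset.mem_Ico.1 (hf k hk j hj)
      have h2 := hJL k hk
      omega
  · refine if_congr ⟨?_, fun h => Or.inr ⟨k, hk, hj, h⟩⟩ rfl rfl
    have h1 := Finset.mem_Ico.1 hr
    have h2 := hJL k hk
    rintro (rfl | ⟨l, hl, hjl, rfl⟩)
    · omega
    · have h3 := Finset.mem_Ico.1 (hf l hl j hjl)
      rcases lt_trichotomy k l with hkl | rfl | hkl
      · have := hlt k l hkl
        omega
      · rfl
      · have := hlt l k hkl
        omega

end Selection

/-! ### Prescribing the digits of a point and of its index -/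

section Prescribe

variable {b : ℕ} [NeZero b] {F : Type*} [Field F] {φ : Fin b ≃ F} {s : ℕ}

lemma genDigit_eq_sum (hb : 2 ≤ b) (hφ : φ 0 = 0) (G : Matrix ℕ ℕ F) {n m : ℕ} (hn : n < b ^ m)
    (j : ℕ) : genDigit φ G n j = ∑ r ∈ Finset.range m, G j r * φ (natDigit b n r) := by
  have hz : ∀ r, n ≤ r ∨ m ≤ r → G j r * φ (natDigit b n r) = 0 := fun r hr => by
    rw [hr.elim (natDigit_eq_zero_of_le hb) (natDigit_eq_zero_of_lt hb hn), hφ, mul_zero]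
  rw [genDigit]
  rcases le_total n m with h | h
  · exact Finset.sum_subset (Finset.range_mono h) fun r _ hr =>
      hz r (Or.inl (by simpa using hr))
  · exact (Finset.sum_subset (Finset.range_mono h) fun r _ hr =>
      hz r (Or.inr (by simpa using hr))).symm

/-- The `r`-th columns of the first `W` rows of the generating matrices, stacked. -/
def stackedColumn (G : Fin s → Matrix ℕ ℕ F) (W r : ℕ) : Fin s × Fin W → F :=
  fun p => G p.1 p.2 r

lemma sum_smul_stackedColumn (hb : 2 ≤ b) (hφ : φ 0 = 0) (G : Fin s → Matrix ℕ ℕ F) (W : ℕ)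
    {n m : ℕ} (hn : n < b ^ m) (p : Fin s × Fin W) :
    (∑ r ∈ Finset.range m, φ (natDigit b n r) • stackedColumn G W r) p =
      genDigit φ (G p.1) n p.2 := by
  rw [genDigit_eq_sum hb hφ _ hn, Finset.sum_apply]
  exact Finset.sum_congr rfl fun r _ => by simp [stackedColumn, mul_comm]

/-- In a digital `(t, s)`-sequence the first `W` digits of all coordinates take all values on the
indices below `b ^ (s W + t)`. -/
lemma exists_low_solution (hb : 2 ≤ b) (hφ : φ 0 = 0) {t : ℕ} {x : ℕ → Fin s → ℝ}
    (hts : IsTSSequence b t x) {G : Fin s → Matrix ℕ ℕ F}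
    (hG : ∀ n i j, Real.digits (x n i) b j = φ.symm (genDigit φ (G i) n j)) (W : ℕ)
    (A : Fin s × Fin W → F) :
    ∃ v : ℕ → F, ∑ r ∈ Finset.range (s * W + t), v r • stackedColumn G W r = A := by
  let c : Fin s → ℕ → Fin b := fun i l =>
    if h : W - 1 - l < W then φ.symm (A (i, ⟨W - 1 - l, h⟩)) else 0
  let a : Fin s → ℕ := fun i => ∑ l ∈ Finset.range W, (c i l : ℕ) * b ^ l
  have ha : ∀ i, a i < b ^ W := fun i => sum_digits_lt (c i) W
  have hcard := (hts.2 0 (s * W + t) (Nat.le_add_left _ _)).2.2 (fun _ => W) a ha (by simp)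
  obtain ⟨n, hn⟩ : {n : Fin (b ^ (s * W + t)) |
      x (0 * b ^ (s * W + t) + n) ∈ elemInterval b (fun _ => W) a}.Nonempty := by
    rw [Set.nonempty_iff_ne_empty]
    intro h0
    rw [h0, Set.ncard_empty] at hcard
    exact absurd hcard.symm (by positivity)
  simp only [zero_mul, zero_add, elemInterval, Set.mem_ofPred_eq] at hn
  refine ⟨fun r => φ (natDigit b n r), ?_⟩
  ext ⟨i, j⟩
  rw [sum_smul_stackedColumn hb hφ G W n.isLt]
  have h1 := (mem_Ico_iff_digits hb (hts.1 n i) (ha i)).1 (hn i) j j.isLt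
  have hj : W - 1 - (W - 1 - (j : ℕ)) = j := by have := j.isLt; omega
  rw [natDigit_sum (c i), if_pos (by have := j.isLt; omega), hG] at h1
  simp only [c, hj, j.isLt, dif_pos] at h1
  exact φ.symm.injective h1

/-- Under the conditions on `C` of `exists_unitriangular`, the first `W` digits of the point with
index `n ⊕ Q` and the lowest `J` digits of the image of `n` under the index permutation can be
prescribed independently of each other. -/
lemma exists_prescribed (hb : 2 ≤ b) (hφ : φ 0 = 0) {t : ℕ} {x : ℕ → Fin s → ℝ}
    (hts : IsTSSequence b t x) {G : Fin s → Matrix ℕ ℕ F}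
    (hG : ∀ n i j, Real.digits (x n i) b j = φ.symm (genDigit φ (G i) n j)) {W J L m : ℕ}
    (hJ : J = s * W + t) (hJL : J ≤ L) (hLm : L ≤ m) {T : Finset ℕ} {f : ℕ → ℕ}
    (hT : T ⊆ Finset.Ico L m)
    (hspan : ∀ r ∈ Finset.Ico L m,
      stackedColumn G W r ∈ Submodule.span F (stackedColumn G W '' T))
    (hinj : Set.InjOn f (Set.Iio J)) (hf : ∀ j, j < J → f j ∈ Finset.Ico L m \ T)
    {C : Matrix ℕ ℕ F}
    (hC : ∀ j, j < J → ∀ r ∈ Finset.Ico L m, C j r = if f j = r then 1 else 0)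
    {Q : ℕ} (hQ : Q < b ^ m) (a : Fin s → ℕ → Fin b) (B : ℕ → Fin b) :
    ∃ n, n < b ^ m ∧ (∀ i j, j < W → Real.digits (x (natAdd b n Q) i) b j = a i j) ∧
      ∀ j, j < J → natDigit b (indexMap φ C m n) j = B j := by
  let σ : ℕ → Equiv.Perm F := fun r =>
    φ.symm.trans ((Equiv.subRight (natDigit b Q r)).trans φ)
  obtain ⟨v, hv, hvC⟩ := exists_solution hJL hLm hT hspan hinj hf hC
    (fun A => hJ ▸ exists_low_solution hb hφ hts hG W A) σ
    (fun p => φ (a p.1 p.2)) fun j => φ (B j)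
  let c : ℕ → Fin b := fun r => φ.symm (v r) - natDigit b Q r
  set n := ∑ r ∈ Finset.range m, (c r : ℕ) * b ^ r with hn
  have hnlt : n < b ^ m := sum_digits_lt c m
  have hdig : ∀ r ∈ Finset.range m, natDigit b n r = c r := fun r hr => by
    rw [hn, natDigit_sum c, if_pos (Finset.mem_range.1 hr)]
  refine ⟨n, hnlt, fun i j hj => ?_, fun j hj => ?_⟩
  · have h1 := sum_smul_stackedColumn hb hφ G W (natAdd_lt_pow hb hnlt hQ) (i, ⟨j, hj⟩)
    have h2 : ∀ r ∈ Finset.range m, φ (natDigit b (natAdd b n Q) r) • stackedColumn G W r =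
        v r • stackedColumn G W r := fun r hr => by
      rw [natDigit_natAdd hb, hdig r hr, sub_add_cancel, Equiv.apply_symm_apply]
    rw [Finset.sum_congr rfl h2, hv] at h1
    rw [hG, ← h1, Equiv.symm_apply_apply]
  · rw [natDigit_indexMap, if_pos (by omega), Equiv.symm_apply_eq, ← hvC j hj]
    refine Finset.sum_congr rfl fun r hr => ?_
    rw [hdig r hr]
    rfl

/-- The sum of `(b - 1) b ^ (t + D S)` over `S < K`: the digit `b - 1` at the indices `t + D S`
and `0` elsewhere. -/
def sparseIndex (b t D K : ℕ) : ℕ := ∑ S ∈ Finset.range K, (b - 1) * b ^ (t + D * S)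

omit [NeZero b] in
lemma pow_add_pred_mul_pow (hb : 2 ≤ b) (e : ℕ) : b ^ e + (b - 1) * b ^ e = b ^ (e + 1) := by
  obtain ⟨c, rfl⟩ := Nat.exists_eq_add_of_le' (by omega : 1 ≤ b)
  rw [Nat.add_sub_cancel]
  ring

omit [NeZero b] in
lemma sparseIndex_lt (hb : 2 ≤ b) {D : ℕ} (hD : 1 ≤ D) (t K : ℕ) :
    sparseIndex b t D K < b ^ (t + D * K) := by
  induction K with
  | zero => simp only [sparseIndex, Finset.range_zero, Finset.sum_empty]; positivity
  | succ K ih =>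
    rw [sparseIndex, Finset.sum_range_succ, ← sparseIndex]
    have h1 : b ^ (t + D * K + 1) ≤ b ^ (t + D * (K + 1)) :=
      Nat.pow_le_pow_right (by omega) (by rw [Nat.mul_succ]; omega)
    have h2 : b ^ (t + D * K) + (b - 1) * b ^ (t + D * K) = b ^ (t + D * K + 1) :=
      pow_add_pred_mul_pow hb _
    omega

omit [NeZero b] in
lemma sparseIndex_mod (hb : 2 ≤ b) {D : ℕ} (hD : 1 ≤ D) (t : ℕ) {S K : ℕ} (hS : S < K) :
    (b - 1) * b ^ (t + D * S) ≤ sparseIndex b t D K % b ^ (t + D * (S + 1)) ∧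
      sparseIndex b t D K % b ^ (t + D * (S + 1)) < b ^ (t + D * S + 1) := by
  have hdvd : b ^ (t + D * (S + 1)) ∣
      ∑ i ∈ Finset.range (K - (S + 1)), (b - 1) * b ^ (t + D * (S + 1 + i)) :=
    Finset.dvd_sum fun i _ => Dvd.dvd.mul_left
      (pow_dvd_pow b (Nat.add_le_add_left (Nat.mul_le_mul_left _ (Nat.le_add_right _ _)) _)) _
  have hsplit : sparseIndex b t D K = sparseIndex b t D (S + 1) +
      ∑ i ∈ Finset.range (K - (S + 1)), (b - 1) * b ^ (t + D * (S + 1 + i)) := by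
    rw [sparseIndex, sparseIndex, ← Finset.sum_range_add, Nat.add_sub_cancel' hS]
  obtain ⟨c, hc⟩ := hdvd
  rw [hsplit, hc, Nat.add_mul_mod_self_left, Nat.mod_eq_of_lt (sparseIndex_lt hb hD t _)]
  have h1 := sparseIndex_lt hb hD t S
  have h2 : b ^ (t + D * S) + (b - 1) * b ^ (t + D * S) = b ^ (t + D * S + 1) :=
    pow_add_pred_mul_pow hb _
  have h3 : sparseIndex b t D (S + 1) = sparseIndex b t D S + (b - 1) * b ^ (t + D * S) :=
    Finset.sum_range_succ _ _
  omega

end Prescribe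

/-! ### The sizes of the blocks -/

lemma blockSize_mono (s d t : ℕ) : Monotone (blockSize s d t) := fun k l hkl =>
  Nat.mul_le_mul_left _ (Nat.sub_le_sub_right
    (Nat.pow_le_pow_right (by norm_num) (by omega)) 1)

/-- The range of columns that is new in the `k`-th block is long enough for `exists_selection`. -/
lemma blockSize_room {s d t k : ℕ} (hs : 2 ≤ s) (hd : 1 ≤ d) (hk : 1 ≤ k) :
    max (blockSize s d t (k - 1)) (s * ((d + t + 1) * 4 ^ k) + t) + s * ((d + t + 1) * 4 ^ k) +
      (s * ((d + t + 1) * 4 ^ k) + t) ≤ blockSize s d t k := by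
  obtain ⟨k, rfl⟩ := Nat.exists_eq_add_one.2 hk
  obtain ⟨n, hn⟩ := Nat.exists_eq_add_one.2 (by positivity : 0 < 4 ^ k)
  have h2 : ∀ i, 2 ^ (2 * i + 2) = 4 * 4 ^ i := fun i => by
    rw [pow_add, pow_mul]; norm_num; ring
  have e1 : blockSize s d t (k + 1 - 1) = s * (s * (d + t)) * (4 * n + 3) := by
    rw [blockSize, h2, Nat.add_sub_cancel, hn, show 4 * (n + 1) - 1 = 4 * n + 3 by omega]
    ring
  have e2 : blockSize s d t (k + 1) = s * (s * (d + t)) * (16 * n + 15) := by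
    rw [blockSize, h2, pow_succ 4 k, hn, show 4 * ((n + 1) * 4) - 1 = 16 * n + 15 by omega]
    ring
  have e3 : s * ((d + t + 1) * 4 ^ (k + 1)) ≤ (s * (d + t)) * (8 * n + 8) := by
    rw [pow_succ, hn]
    have : d + t + 1 ≤ 2 * (d + t) := by omega
    calc s * ((d + t + 1) * ((n + 1) * 4)) ≤ s * (2 * (d + t) * ((n + 1) * 4)) := by gcongr
      _ = _ := by ring
  have ht : t ≤ s * (d + t) := by nlinarith
  rw [e1, e2]
  generalize s * ((d + t + 1) * 4 ^ (k + 1)) = V at e3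
  generalize s * (d + t) = X at e3 ht
  have h3 : 2 * X ≤ s * X := Nat.mul_le_mul_right _ hs
  generalize s * X = Y at h3
  have h4 : 2 * X * n ≤ Y * n := Nat.mul_le_mul_right _ h3
  have h5 : 0 ≤ X * n := Nat.zero_le _
  rcases max_choice (Y * (4 * n + 3)) (V + t) with h | h <;> rw [h] <;> nlinarith

lemma blockSize_le {s d t : ℕ} (k : ℕ) :
    (blockSize s d t k : ℝ) ≤ constK d t (s + 1) * 4 ^ k := by
  have h : blockSize s d t k ≤ s ^ 2 * (d + t) * (4 * 4 ^ k) :=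
    Nat.mul_le_mul_left _ ((Nat.sub_le _ 1).trans_eq (by
      rw [pow_add, pow_mul]; norm_num; ring))
  calc (blockSize s d t k : ℝ) ≤ ((s ^ 2 * (d + t) * (4 * 4 ^ k) : ℕ) : ℝ) := by exact_mod_cast h
    _ = _ := by
      rw [constK]
      push_cast
      ring

lemma bound_le {b s d t : ℕ} (hb : 2 ≤ b) (hs : 2 ≤ s) (hd : 1 ≤ d) (k : ℕ) :
    (1 / 4 : ℝ) * ((b : ℝ) ^ d)⁻¹ * (constK d t (s + 1) ^ s)⁻¹ * (blockSize s d t k : ℝ) ^ s ≤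
      ((4 ^ k : ℕ) : ℝ) ^ s * (((b : ℝ) - 1) * ((b : ℝ) ^ (d + 1))⁻¹) := by
  have hb2 : (2 : ℝ) ≤ b := by exact_mod_cast hb
  have hd1 : (1 : ℝ) ≤ d := by exact_mod_cast hd
  have hs2 : (2 : ℝ) ≤ s := by exact_mod_cast hs
  have hK : 0 < constK d t (s + 1) := by
    rw [constK]
    push_cast
    rw [add_sub_cancel_right]
    positivity
  have h1 : (constK d t (s + 1) ^ s)⁻¹ * (blockSize s d t k : ℝ) ^ s ≤ (4 ^ k) ^ s := by
    rw [inv_mul_le_iff₀ (by positivity), ← mul_pow]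
    exact pow_le_pow_left₀ (Nat.cast_nonneg _) (blockSize_le k) s
  have h2 : (1 / 4 : ℝ) * ((b : ℝ) ^ d)⁻¹ ≤ ((b : ℝ) - 1) * ((b : ℝ) ^ (d + 1))⁻¹ := by
    have : ((b : ℝ) ^ d)⁻¹ = b * ((b : ℝ) ^ (d + 1))⁻¹ := by
      rw [pow_succ]
      field_simp
    rw [this, ← mul_assoc]
    gcongr
    linarith
  calc _ = ((1 / 4 : ℝ) * ((b : ℝ) ^ d)⁻¹) *
        ((constK d t (s + 1) ^ s)⁻¹ * (blockSize s d t k : ℝ) ^ s) := by ring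
    _ ≤ (((b : ℝ) - 1) * ((b : ℝ) ^ (d + 1))⁻¹) * (4 ^ k) ^ s := by
      refine mul_le_mul h2 h1 (by positivity) (mul_nonneg (by linarith) (by positivity))
    _ = _ := by
      push_cast
      ring

end DigitalSeq

open DigitalSeq in
theorem theorem6 (b : ℕ) [NeZero b] {F : Type*} [Field F] (φ : Fin b ≃ F) (hφ : φ 0 = 0)
    (s d t : ℕ) (hs : 2 ≤ s) (hd : 1 ≤ d) (x : ℕ → Fin s → ℝ)
    (hdig : DigitalSeq.IsDigital φ x) (hadm : DigitalSeq.IsAdmissible b d x)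
    (hts : DigitalSeq.IsTSSequence b t x) :
    ∃ (C : Matrix ℕ ℕ F) (hinv : ℕ → ℕ),
      (∀ k : ℕ, 1 ≤ k →
        IsUnit (DigitalSeq.leadBlock C (DigitalSeq.blockSize s d t k))) ∧
      (∀ k l : ℕ, 1 ≤ k → k < l → ∀ n : ℕ, n < b ^ DigitalSeq.blockSize s d t k →
        hinv n = DigitalSeq.indexMapInv φ C (DigitalSeq.blockSize s d t l) n ∧
        hinv n = DigitalSeq.indexMapInv φ C (DigitalSeq.blockSize s d t k) n) ∧
      DigitalSeq.IsAdmissible b d (fun n => x (hinv n)) ∧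
      DigitalSeq.IsTSSequence b t (fun n => x (hinv n)) ∧
      ∀ k : ℕ, 1 ≤ k →
        ∀ Q : ℕ, Q < b ^ DigitalSeq.blockSize s d t k →
        ∀ w ∈ DigitalSeq.gridPoints b (DigitalSeq.blockSize s d t k) s,
        ∃ N : ℕ, 1 ≤ N ∧ N ≤ b ^ DigitalSeq.blockSize s d t k ∧
          (1 / 4 : ℝ) * ((b : ℝ) ^ d)⁻¹ * (DigitalSeq.constK d t (s + 1) ^ s)⁻¹ *
              (DigitalSeq.blockSize s d t k : ℝ) ^ s ≤
            1 + (N : ℝ) * DigitalSeq.starDisc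
              (fun n => DigitalSeq.pointAdd b (x (DigitalSeq.natAdd b (hinv n) Q)) w) N := by
  have hb : 2 ≤ b := by
    rw [← Fin.nontrivial_iff_two_le]
    exact φ.nontrivial
  obtain ⟨G, hGx⟩ := hdig
  have hG : ∀ n i, Real.digits (x n i) b = fun j => φ.symm (genDigit φ (G i) n j) := fun n i => by
    rw [(hGx n i).2, digits_ofDigits hb (hGx n i).1]
  have hfreq : ∀ n i, ∃ᶠ j in Filter.atTop, (Real.digits (x n i) b j : ℕ) ≠ b - 1 := fun n i => by
    rw [hG]
    exact (hGx n i).1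
  -- The points are prescribed up to the digit `W k` and their indices up to the digit `J k`; the
  -- columns from `L k` to `blockSize k` serve to decouple the two.
  set D := d + t + 1 with hD
  let W : ℕ → ℕ := fun k => D * 4 ^ k
  let J : ℕ → ℕ := fun k => s * W k + t
  let L : ℕ → ℕ := fun k => max (blockSize s d t (k - 1)) (J k)
  have hroom : ∀ k, 1 ≤ k → L k + s * W k + J k ≤ blockSize s d t k := fun k hk =>
    blockSize_room hs hd hk
  have hsel : ∀ k, ∃ (T : Finset ℕ) (f : ℕ → ℕ), 1 ≤ k →
      T ⊆ Finset.Ico (L k) (blockSize s d t k) ∧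
      (∀ r ∈ Finset.Ico (L k) (blockSize s d t k),
        stackedColumn G (W k) r ∈ Submodule.span F (stackedColumn G (W k) '' T)) ∧
      Set.InjOn f (Set.Iio (J k)) ∧
      ∀ j, j < J k → f j ∈ Finset.Ico (L k) (blockSize s d t k) \ T := fun k => by
    by_cases hk : 1 ≤ k
    · obtain ⟨T, f, h⟩ := exists_selection (stackedColumn G (W k)) (L := L k) (J := J k)
        (m := blockSize s d t k) (by simpa using hroom k hk)
      exact ⟨T, f, fun _ => h⟩
    · exact ⟨∅, id, fun h => absurd h hk⟩
  choose T f hTf using hsel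
  obtain ⟨C, hC1, hC0, hC⟩ := exists_unitriangular (F := F) f (J := J) (L := L)
    (blockSize_mono s d t) (fun k _ => le_max_right _ _) (fun k => le_max_left _ _)
    fun k hk j hj => Finset.sdiff_subset ((hTf k hk).2.2.2 j hj)
  obtain ⟨h, hblock, hh⟩ := exists_indexMapInv_glue (φ := φ) hb hφ hC1 hC0
  refine ⟨C, h, fun k _ => isUnit_leadBlock hC1 hC0 _, fun k l _ hkl n hn => ⟨hh _ n ?_, hh _ n hn⟩,
    hadm.comp hb hblock, hts.comp hblock, fun k hk Q hQ w hw => ?_⟩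
  · exact hn.trans_le (Nat.pow_le_pow_right (by omega) (blockSize_mono s d t hkl.le))
  have hblock' := (blockPreserving_natAdd hb Q).comp hblock
  set z : ℕ → Fin s → ℝ := fun n => pointAdd b (x (natAdd b (h n) Q)) w with hz
  have hzdig : ∀ n i j, Real.digits (z n i) b j =
      Real.digits (x (natAdd b (h n) Q) i) b j + Real.digits (w i) b j := fun n i j =>
    congrFun (digits_ofDigits hb (frequently_digits_add hw (hfreq _ i))) j
  have hzmem : ∀ n i, z n i ∈ Set.Ico (0 : ℝ) 1 := fun n i =>
    ofDigits_mem_Ico hb (frequently_digits_add hw (hfreq _ i))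
  have hzts : IsTSSequence b t z := (hts.comp hblock').of_digits_add hb hzmem hzdig
  have hzadm : IsAdmissible b d z := (hadm.comp hb hblock').of_digits_add hzdig
  set m := blockSize s d t k with hm
  have hLm : L k ≤ m := by have := hroom k hk; omega
  obtain ⟨hT, hspan, hinj, hf⟩ := hTf k hk
  obtain ⟨n₀, hn₀, hdigx, hdigN⟩ := exists_prescribed hb hφ hts
    (fun n i j => congrFun (hG n i) j) rfl (le_max_right _ _) hLm hT hspan hinj hf (hC k hk) hQ
    (fun i j => natDigit b (repunit b D (4 ^ k)) (W k - 1 - j) - Real.digits (w i) b j)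
    (natDigit b (sparseIndex b t D (s * 4 ^ k)))
  set N := indexMap φ C m n₀ with hNdef
  have hNlt : N < b ^ m := indexMap_lt m n₀
  have hhN : h N = n₀ := by rw [hh m N hNlt, hNdef, indexMapInv_eq hb hC1 hC0 hn₀]
  have hD1 : 1 ≤ D := by omega
  have hNmod : ∀ S, S < s * 4 ^ k →
      (b - 1) * b ^ (t + D * S) ≤ N % b ^ (t + D * (S + 1)) ∧
        N % b ^ (t + D * (S + 1)) < b ^ (t + D * S + 1) := fun S hS => by
    have hle : t + D * (S + 1) ≤ J k := by
      have : D * (S + 1) ≤ D * (s * 4 ^ k) := Nat.mul_le_mul_left _ hS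
      have e : J k = D * (s * 4 ^ k) + t := by simp only [J, W]; ring
      omega
    rw [mod_pow_eq_of_natDigit fun j hj => hdigN j (hj.trans_le hle)]
    exact sparseIndex_mod hb hD1 t hS
  have hzN : ∀ i, z N i ∈
      Set.Ico (corner b D (4 ^ k)) (corner b D (4 ^ k) + ((b : ℝ) ^ (D * 4 ^ k))⁻¹) := fun i => by
    have h1 := (mem_Ico_iff_digits hb (hzmem N i) (repunit_lt hb hD1 (4 ^ k))).2 fun j hj => by
      rw [hzdig, hhN, hdigx i j hj, sub_add_cancel]
    rwa [add_div, one_div] at h1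
  have hM : 1 ≤ 4 ^ k := Nat.one_le_pow _ _ (by norm_num)
  have hN1 : 1 ≤ N := by
    have h1 := (hNmod 0 (by positivity)).1
    have h2 : 0 < (b - 1) * b ^ (t + D * 0) := Nat.mul_pos (by omega) (by positivity)
    have h3 := Nat.mod_le N (b ^ (t + D * (0 + 1)))
    omega
  have hdisc := localDisc_corner_le hb (by omega) hzts hzadm hD hNmod hzN
  have habs := abs_localDisc_le z hN1 (y := fun _ => corner b D (4 ^ k))
    fun _ => ⟨corner_pos hb D hM, corner_le_one hb hD1 _⟩
  refine ⟨N, hN1, hNlt.le, (bound_le hb hs hd k).trans ?_⟩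
  have h1 := neg_abs_le (localDisc z N fun _ => corner b D (4 ^ k))
  linarith
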